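/- Let $n\ge 0$. A partial flag $\mathcal F$ of $\mathbb R^n$ is a strictly descending chain of subspaces $\mathbb R^n=V_0\supsetneq V_1\supsetneq\cdots\supsetneq V_k\supsetneq V_{k+1}=\{0\}$. (For $n=0$ the only flag is the one-term chain $V_0=\{0\}$, with no quotients.) A partial flag of quadratic forms $\beta=(\beta_0,\dots,\beta_k)$ on $\mathcal F$ consists of a non-degenerate real quadratic form $\beta_i$ on each quotient $V_i/V_{i+1}$. Let $\operatorname{Isom}(\mathcal F,\beta)\subset \operatorname{GL}_n\mathbb R$ be the group of linear automorphisms that preserve every $V_i$ and induce an isometry of every $\beta_i$, and let $\operatorname{P}\operatorname{Isom}(\mathcal F,\beta)$ be its image in $\operatorname{PGL}_n\mathbb R$. The signature of $\beta$ is $((p_0,q_0),\dots,(p_k,q_k))$, where $p_i$ (resp. $q_i$) is the maximal dimension of a subspace on which $\beta_i$ is negative (resp. positive) definite. A sequence $(H_r)$ of closed subgroups of a Lie group $G$ converges geometrically to a closed subgroup $L$ if every $g\in L$ is the limit of some sequence $h_r\in H_r$, and every accumulation point of every sequence $h_r\in H_r$ lies in $L$. A subgroup $L$ is a conjugacy limit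 of $H$ in $G$ if there are $c_r\in G$ such that the groups $c_rHc_r^{-1}$ converge geometrically to $L$. Fix a partial flag $\mathcal F=\{V_i\}$ with a partial flag of quadratic forms $\beta$ of signature $((p_i,q_i))_i$. Say that a pair $(\mathcal F',\beta')$, with $\mathcal F'=\{W_j\}$ and $\beta'$ of signature $((p'_j,q'_j))_j$, refines $(\mathcal F,\beta)$ up to conjugation if there is $g\in\operatorname{GL}_n\mathbb R$ such that the translated flag $g\mathcal F'=\{V'_j\}$, $V'_j=gW_j$, is a refinement of $\mathcal F$ (every $V_i$ is one of the $V'_j$) and, after exchanging $(p'_j,q'_j)$ with $(q'_j,p'_j)$ for some collection of indices $j$, for all $i$ $$p_i=\sum_{j:\,V_i\supseteq V'_j\supsetneq V_{i+1}}p'_j,\qquad q_i=\sum_{j:\,V_i\supseteq V'_j\supsetneq V_{i+1}}q'_j .$$ Then: (1) Every conjugacy limit of $\operatorname{Isom}(\mathcal F,\beta)$ in $\operatorname{GL}_n\mathbb R$ is of the form $\operatorname{Isom}(\mathcal F',\beta')$ for some partial flag of quadratic forms $\beta'$ on a partial flag $\mathcal F'$ of $\mathbb R^n$; and for every such pair $(\mathcal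 F',\beta')$, the group $\operatorname{Isom}(\mathcal F',\beta')$ is a conjugacy limit of $\operatorname{Isom}(\mathcal F,\beta)$ if and only if $(\mathcal F',\beta')$ refines $(\mathcal F,\beta)$ up to conjugation. (2) The same holds for $\operatorname{P}\operatorname{Isom}$ in $\operatorname{PGL}_n\mathbb R$: every conjugacy limit of $\operatorname{P}\operatorname{Isom}(\mathcal F,\beta)$ is of the form $\operatorname{P}\operatorname{Isom}(\mathcal F',\beta')$; and for every pair $(\mathcal F',\beta')$, the group $\operatorname{P}\operatorname{Isom}(\mathcal F',\beta')$ is a conjugacy limit of $\operatorname{P}\operatorname{Isom}(\mathcal F,\beta)$ if and only if $(\mathcal F',\beta')$ refines $(\mathcal F,\beta)$ up to conjugation. -/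

import Mathlib

open Filter Topology
open scoped MatrixGroups

/-! ### Geometric limits of subgroups -/

/-- Geometric (Chabauty) convergence of a sequence of closed subgroups `H k` of a topological group
to a closed subgroup `L`: every element of `L` is the limit of some sequence `h k ∈ H k`, and every
accumulation point of every sequence `h k ∈ H k` lies in `L`. -/
structure ConvergesGeometrically {G : Type*} [Group G] [TopologicalSpace G]
    (H : ℕ → Subgroup G) (L : Subgroup G) : Prop where
  isClosed_seq : ∀ k, IsClosed (H k : Set G)
  isClosed_limit : IsClosed (L : Set G)
  exists_tendsto : ∀ g ∈ L, ∃ h : ℕ → G, (∀ k, h k ∈ H k) ∧ Tendsto h atTop (𝓝 g)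
  clusterPt_mem : ∀ h : ℕ → G, (∀ k, h k ∈ H k) → ∀ g : G, MapClusterPt g atTop h → g ∈ L

/-- `L` is a conjugacy limit of `H` if `c k * H * (c k)⁻¹` converges geometrically to `L` for some
sequence `c` of group elements. -/
def IsConjugacyLimit {G : Type*} [Group G] [TopologicalSpace G] (H L : Subgroup G) : Prop :=
  ∃ c : ℕ → G, ConvergesGeometrically (fun k => H.map (MulAut.conj (c k)).toMonoidHom) L

/-- The quotient topology on `PGL(n, ℝ) = GL(n, ℝ) / center`. -/
instance instTopologicalSpacePGL (n : ℕ) : TopologicalSpace (PGL(n, ℝ)) :=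
  TopologicalSpace.coinduced (Matrix.ProjGenLinGroup.mk (n := Fin n) (R := ℝ)) inferInstance

/-! ### Partial flags -/

/-- A partial flag of `ℝⁿ` with `m` steps: a chain of subspaces
`ℝⁿ = V 0 ⊋ V 1 ⊋ ⋯ ⊋ V m = 0`. -/
structure PartialFlag (n m : ℕ) where
  V : Fin (m + 1) → Submodule ℝ (Fin n → ℝ)
  V_zero : V 0 = ⊤
  V_last : V (Fin.last m) = ⊥
  strictAnti : StrictAnti V

/-- The linear automorphism of `ℝⁿ` given by an invertible matrix, `x ↦ g x`. -/
noncomputable def glEquiv {n : ℕ} (g : GL (Fin n) ℝ) : (Fin n → ℝ) ≃ₗ[ℝ] (Fin n → ℝ) :=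
  LinearMap.GeneralLinearGroup.generalLinearEquiv ℝ (Fin n → ℝ)
    (Matrix.GeneralLinearGroup.toLin g)

theorem glEquiv_apply {n : ℕ} (g : GL (Fin n) ℝ) (x : Fin n → ℝ) :
    glEquiv g x = (g : Matrix (Fin n) (Fin n) ℝ).mulVec x := by
  rfl

namespace PartialFlag

variable {n m m' : ℕ}

/-- The quotient `V i / V (i + 1)` of a partial flag. -/
abbrev Piece (F : PartialFlag n m) (i : Fin m) : Type :=
  F.V i.castSucc ⧸ (F.V i.succ).submoduleOf (F.V i.castSucc)

/-- The class in `V i / V (i + 1)` of a vector of `V i`. -/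
def toPiece (F : PartialFlag n m) (i : Fin m) (x : F.V i.castSucc) : F.Piece i :=
  Submodule.Quotient.mk x

/-- The translate `g F` of a partial flag by an invertible matrix. -/
noncomputable def translate (g : GL (Fin n) ℝ) (F : PartialFlag n m) : PartialFlag n m where
  V i := (F.V i).map (glEquiv g).toLinearMap
  V_zero := by simp [F.V_zero]
  V_last := by simp [F.V_last]
  strictAnti := fun _ _ hij =>
    Submodule.map_strictMono_of_injective (glEquiv g).injective (F.strictAnti hij)

/-- The flag `F'` refines the flag `F`: every subspace of `F` is a subspace of `F'`. -/
def Refines (F' : PartialFlag n m') (F : PartialFlag n m) : Prop :=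
  ∀ i, ∃ j, F'.V j = F.V i

end PartialFlag

/-- A partial flag of quadratic forms: a non-degenerate quadratic form on each quotient
`V i / V (i + 1)` of the partial flag `F`. -/
structure FlagForms {n m : ℕ} (F : PartialFlag n m) where
  form : ∀ i : Fin m, QuadraticForm ℝ (F.Piece i)
  nondegenerate : ∀ i, (form i).Nondegenerate

namespace FlagForms

variable {n m : ℕ} {F : PartialFlag n m}

/-- The signature `((p 0, q 0), (p 1, q 1), …)`, where `p i` (resp. `q i`) is the largest dimension
of a subspace on which the `i`-th form is negative (resp. positive) definite. -/
noncomputable def signature (β : FlagForms F) (i : Fin m) : ℕ × ℕ :=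
  (sigNeg (β.form i), sigPos (β.form i))

/-- `Isom(F, β)`: the invertible matrices that preserve every subspace of the flag and induce an
isometry of every form of `β`. -/
def isom (β : FlagForms F) : Subgroup (GL (Fin n) ℝ) where
  carrier := {g | (∀ i, (F.V i).map (glEquiv g).toLinearMap = F.V i) ∧
    ∀ (i : Fin m) (x y : F.V i.castSucc), (y : Fin n → ℝ) = glEquiv g x →
      β.form i (F.toPiece i y) = β.form i (F.toPiece i x)}
  one_mem' := by
    have h1 : ∀ x, glEquiv (1 : GL (Fin n) ℝ) x = x := fun x => by simp [glEquiv_apply]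
    refine ⟨fun i => ?_, fun i x y hxy => ?_⟩
    · have : (glEquiv (1 : GL (Fin n) ℝ)).toLinearMap = LinearMap.id := LinearMap.ext h1
      rw [this, Submodule.map_id]
    · rw [h1] at hxy
      rw [Subtype.ext hxy]
  mul_mem' := by
    rintro a b ⟨ha, ha'⟩ ⟨hb, hb'⟩
    have hm : ∀ x, glEquiv (a * b) x = glEquiv a (glEquiv b x) := fun x => by
      simp [glEquiv_apply]
    refine ⟨fun i => ?_, fun i x y hxy => ?_⟩
    · have : (glEquiv (a * b)).toLinearMap = (glEquiv a).toLinearMap ∘ₗ (glEquiv b).toLinearMap :=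
        LinearMap.ext hm
      rw [this, Submodule.map_comp, hb, ha]
    · have hz : glEquiv b x ∈ F.V i.castSucc :=
        (hb i.castSucc).le (Submodule.mem_map_of_mem x.2)
      rw [ha' i ⟨_, hz⟩ y (by rw [hxy, hm]), hb' i x ⟨_, hz⟩ rfl]
  inv_mem' := by
    rintro a ⟨ha, ha'⟩
    have hm : ∀ x, glEquiv a (glEquiv a⁻¹ x) = x := fun x => by
      rw [glEquiv_apply, glEquiv_apply, Matrix.mulVec_mulVec, ← Units.val_mul]; simp
    refine ⟨fun i => ?_, fun i x y hxy => ?_⟩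
    · apply Submodule.map_injective_of_injective (glEquiv a).injective
      rw [← Submodule.map_comp]
      have : (glEquiv a).toLinearMap ∘ₗ (glEquiv a⁻¹).toLinearMap = LinearMap.id :=
        LinearMap.ext hm
      simp only [this, Submodule.map_id]
      exact (ha i).symm
    · exact (ha' i y x (by rw [hxy, hm])).symm

/-- `P Isom(F, β)`: the image of `Isom(F, β)` in `PGL(n, ℝ)`. -/
def pIsom (β : FlagForms F) : Subgroup (PGL(n, ℝ)) :=
  β.isom.map Matrix.ProjGenLinGroup.mk

end FlagForms

open Classical in
/-- The signature `s'` of a flag `F'` refines the signature `s` of a flag `F`: after exchanging the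
two entries of `s' j` for some collection `S` of indices `j`, for every `i` the pair `s i` is the
sum of the pairs `s' j` over the indices `j` such that `V i ⊇ V' j ⊋ V (i + 1)`. -/
def SignatureRefines {n m m' : ℕ} (F' : PartialFlag n m') (s' : Fin m' → ℕ × ℕ)
    (F : PartialFlag n m) (s : Fin m → ℕ × ℕ) : Prop :=
  ∃ S : Finset (Fin m'), ∀ i : Fin m,
    s i = ∑ j with F'.V j.castSucc ≤ F.V i.castSucc ∧ F.V i.succ < F'.V j.castSucc,
      if j ∈ S then (s' j).swap else s' j

/-- Up to conjugation, the flag of `β'` refines the flag of `β`, and the signature of `β'` refines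
that of `β`. (Translating `β'` along with its flag does not change its signature.) -/
def RefinesUpToConj {n m m' : ℕ} {F' : PartialFlag n m'} {F : PartialFlag n m}
    (β' : FlagForms F') (β : FlagForms F) : Prop :=
  ∃ g : GL (Fin n) ℝ, (F'.translate g).Refines F ∧
    SignatureRefines (F'.translate g) β'.signature F β.signature

/-! In a basis adapted to the flag and diagonalizing the forms with entries ±1, `Isom(F, β)` becomes
`blockGroup b ε`: block lower triangular matrices whose diagonal blocks preserve signed sums of
squares.

For an arbitrary conjugator `c`, the spectral theorem on the graded pieces, for the inner product
pulled back by `c`, gives an adapted basis `g` with `c * g = o * diagGL t` and `o` orthogonal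
(`exists_adapted_orthogonal`). So conjugating by `c` amounts to conjugating the block group by a
diagonal matrix and then by an orthogonal one. Along a nonprincipal ultrafilter `b` and `ε` are
eventually constant, `o` converges by compactness, and `t` splits into a convergent factor and a
factor constant on classes of entries of comparable size (`exists_split_diag`). Thus only diagonal
conjugation with separated scales matters.

For that, `filterLim_diagGL` computes the limit. Conjugation multiplies the relation between an
entry of the inverse and the transposed entry by `(t i / t j) ^ 2`. When this tends to 0 the form
splits between the two scales and the limit is block triangular for the finer numbering `b'`, with
the same signs. Conversely every block unipotent element is reached, by correcting its Cayley
parameter to a skew one. Hence every limit is the isometry group of a refinement.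

For the converse direction, the powers `(k + 1) ^ b' j` realize any refinement once the bases are
matched by a permutation. Exchanging `p` and `q` on a piece negates a form, which leaves the group
unchanged. To know that a given `β'` refines `β`, and not just some `β''` with the same group,
rigidity is needed: the group determines the flag, and each form up to a nonzero scalar
(`RefinesUpToConj.of_isom_eq`).

The projective case follows because isometry groups consist of matrices of determinant ±1 and
contain `-1`: limits in `PGL` lift to `GL` after a choice of sign (`exists_lift_tendsto`). -/

/-! ### Limits of subgroups along filters -/

section FilterLimits

variable {G : Type*} [Group G]

theorem mem_map_conj_iff {H : Subgroup G} {c g : G} :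
    g ∈ H.map (MulAut.conj c).toMonoidHom ↔ c⁻¹ * g * c ∈ H := by
  constructor
  · rintro ⟨h, hh, rfl⟩
    simpa [mul_assoc] using hh
  · intro h
    exact ⟨_, h, by simp [mul_assoc]⟩

theorem map_conj_mul (H : Subgroup G) (a b : G) :
    H.map (MulAut.conj (a * b)).toMonoidHom =
      (H.map (MulAut.conj b).toMonoidHom).map (MulAut.conj a).toMonoidHom := by
  ext g
  simp only [mem_map_conj_iff, mul_inv_rev, mul_assoc]

variable [TopologicalSpace G]

/-- `L` consists exactly of the limits along `l` of families `h k` with `h k ∈ H k` eventually. -/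
def FilterLim {ι : Type*} (l : Filter ι) (H : ι → Subgroup G) (L : Subgroup G) : Prop :=
  ∀ g, g ∈ L ↔ ∃ h : ι → G, (∀ᶠ k in l, h k ∈ H k) ∧ Tendsto h l (𝓝 g)

/-- This identifies an abstract geometric limit with one computed along a single ultrafilter. -/
theorem FilterLim.unique {ι : Type*} {l : Filter ι} {H : ι → Subgroup G} {L L' : Subgroup G}
    (h : FilterLim l H L) (h' : FilterLim l H L') : L = L' := by
  ext g
  rw [h g, h' g]

theorem FilterLim.congr {ι : Type*} {l : Filter ι} {H H' : ι → Subgroup G} {L : Subgroup G}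
    (h : FilterLim l H L) (hH : ∀ᶠ k in l, H k = H' k) : FilterLim l H' L := by
  intro g
  rw [h g]
  refine exists_congr fun f => and_congr_left fun _ => eventually_congr ?_
  filter_upwards [hH] with k hk
  rw [hk]

theorem FilterLim.conj [IsTopologicalGroup G] {ι : Type*} {l : Filter ι} {H : ι → Subgroup G}
    {L : Subgroup G} (h : FilterLim l H L) {a : ι → G} {c : G} (ha : Tendsto a l (𝓝 c)) :
    FilterLim l (fun k => (H k).map (MulAut.conj (a k)).toMonoidHom)
      (L.map (MulAut.conj c).toMonoidHom) := by
  intro g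
  rw [mem_map_conj_iff, h]
  constructor
  · rintro ⟨f, hf, hfg⟩
    refine ⟨fun k => a k * f k * (a k)⁻¹, hf.mono fun k hk => ?_, ?_⟩
    · rw [mem_map_conj_iff]
      simpa [mul_assoc] using hk
    · simpa [mul_assoc] using (ha.mul hfg).mul ha.inv
  · rintro ⟨f, hf, hfg⟩
    exact ⟨fun k => (a k)⁻¹ * f k * a k, hf.mono fun k hk => mem_map_conj_iff.1 hk,
      (ha.inv.mul hfg).mul ha⟩

/-- Geometric convergence passes to every finer proper filter, since a limit along such a filter is
an accumulation point of the sequence. -/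
theorem ConvergesGeometrically.filterLim {H : ℕ → Subgroup G} {L : Subgroup G}
    (h : ConvergesGeometrically H L) {l : Filter ℕ} [l.NeBot] (hl : l ≤ atTop) :
    FilterLim l H L := by
  classical
  intro g
  constructor
  · intro hg
    obtain ⟨f, hf, hfg⟩ := h.exists_tendsto g hg
    exact ⟨f, Eventually.of_forall hf, hfg.mono_left hl⟩
  · rintro ⟨f, hf, hfg⟩
    -- Membership holds only eventually along `l`; the value 1 elsewhere makes it hold for every
    -- index without changing the limit.
    refine h.clusterPt_mem (fun k => if f k ∈ H k then f k else 1) (fun k => ?_) g ?_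
    · split_ifs with hk
      · exact hk
      · exact one_mem _
    · have : Tendsto (fun k => if f k ∈ H k then f k else 1) l (𝓝 g) := by
        refine hfg.congr' ?_
        filter_upwards [hf] with k hk
        rw [if_pos hk]
      exact this.mapClusterPt.mono hl

/-- All finer filters are required in the hypothesis because an accumulation point is a limit only
along some ultrafilter below `atTop`. -/
theorem convergesGeometrically_of_filterLim {H : ℕ → Subgroup G} {L : Subgroup G}
    (hH : ∀ k, IsClosed (H k : Set G)) (hL : IsClosed (L : Set G))
    (h : ∀ l : Filter ℕ, l.NeBot → l ≤ atTop → FilterLim l H L) :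
    ConvergesGeometrically H L := by
  classical
  refine ⟨hH, hL, fun g hg => ?_, fun f hf g hg => ?_⟩
  · obtain ⟨f, hf, hfg⟩ := (h atTop inferInstance le_rfl g).1 hg
    refine ⟨fun k => if f k ∈ H k then f k else 1, fun k => ?_, hfg.congr' ?_⟩
    · dsimp only
      split_ifs with hk
      · exact hk
      · exact one_mem _
    · filter_upwards [hf] with k hk
      rw [if_pos hk]
  · obtain ⟨u, hu, hug⟩ := mapClusterPt_iff_ultrafilter.1 hg
    exact (h u inferInstance hu g).2 ⟨f, Eventually.of_forall hf, hug⟩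

theorem isClosed_map_conj [IsTopologicalGroup G] {H : Subgroup G} (hH : IsClosed (H : Set G))
    (c : G) : IsClosed (H.map (MulAut.conj c).toMonoidHom : Set G) := by
  have : (H.map (MulAut.conj c).toMonoidHom : Set G) = (fun g => c⁻¹ * g * c) ⁻¹' H := by
    ext g
    exact mem_map_conj_iff
  rw [this]
  exact hH.preimage (by fun_prop)

theorem isConjugacyLimit_of_filterLim [IsTopologicalGroup G] {H L : Subgroup G}
    (hH : IsClosed (H : Set G)) (hL : IsClosed (L : Set G)) (c : ℕ → G)
    (h : ∀ l : Filter ℕ, l.NeBot → l ≤ atTop →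
      FilterLim l (fun k => H.map (MulAut.conj (c k)).toMonoidHom) L) : IsConjugacyLimit H L :=
  ⟨c, convergesGeometrically_of_filterLim (fun k => isClosed_map_conj hH (c k)) hL h⟩

end FilterLimits

/-! ### Lifting limits to units -/

section UnitsLimits

variable {R : Type*} [NormedRing R] [CompleteSpace R]

theorem exists_tendsto_units {ι : Type*} {l : Filter ι} {M : ι → R} {u : Rˣ}
    (h : Tendsto M l (𝓝 (u : R))) :
    ∃ f : ι → Rˣ, Tendsto f l (𝓝 u) ∧ ∀ᶠ k in l, (f k : R) = M k := by
  classical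
  have hev : ∀ᶠ k in l, IsUnit (M k) := h.eventually (Units.isOpen.mem_nhds u.isUnit)
  refine ⟨fun k => if hk : IsUnit (M k) then hk.unit else 1, ?_, ?_⟩
  · rw [Units.isOpenEmbedding_val.tendsto_nhds_iff]
    refine h.congr' ?_
    filter_upwards [hev] with k hk
    simp [hk]
  · filter_upwards [hev] with k hk
    simp [hk]

end UnitsLimits

/-! ### Block triangular groups preserving signed sums of squares -/

section BlockGroups

/-- The sign `±1` as a real number. -/
def sgn (u : ℤˣ) : ℝ := ((u : ℤ) : ℝ)

theorem sgn_mul_self (u : ℤˣ) : sgn u * sgn u = 1 := by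
  rcases Int.units_eq_one_or u with rfl | rfl <;> simp [sgn]

theorem sgn_ne_zero (u : ℤˣ) : sgn u ≠ 0 := by
  rcases Int.units_eq_one_or u with rfl | rfl <;> simp [sgn]

variable {n : ℕ}

/-- `A` is block lower triangular with respect to the block numbers `b`. -/
def BlockLower (b : Fin n → ℕ) (A : Matrix (Fin n) (Fin n) ℝ) : Prop :=
  ∀ i j, b i < b j → A i j = 0

theorem BlockLower.mul {b : Fin n → ℕ} {A B : Matrix (Fin n) (Fin n) ℝ} (hA : BlockLower b A)
    (hB : BlockLower b B) : BlockLower b (A * B) := by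
  intro i j hij
  rw [Matrix.mul_apply]
  refine Finset.sum_eq_zero fun k _ => ?_
  by_cases h : b i < b k
  · rw [hA i k h, zero_mul]
  · rw [hB k j (by omega), mul_zero]

theorem BlockLower.one (b : Fin n → ℕ) : BlockLower b 1 := fun i j hij =>
  Matrix.one_apply_ne (by rintro rfl; exact lt_irrefl _ hij)

theorem BlockLower.mul_apply {b : Fin n → ℕ} {A B : Matrix (Fin n) (Fin n) ℝ}
    (hA : BlockLower b A) (hB : BlockLower b B) {i j : Fin n} (hij : b i = b j) :
    (A * B) i j = ∑ k with b k = b i, A i k * B k j := by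
  rw [Matrix.mul_apply, Finset.sum_filter]
  refine Finset.sum_congr rfl fun k _ => ?_
  split_ifs with hk
  · rfl
  · rcases lt_or_gt_of_ne hk with h | h
    · rw [hB k j (by omega), mul_zero]
    · rw [hA i k h, zero_mul]

theorem BlockLower.units_inv {b : Fin n → ℕ} {A : GL (Fin n) ℝ} (hA : BlockLower b A.val) :
    BlockLower b (A⁻¹).val := by
  have hA' : Matrix.BlockTriangular A.val (OrderDual.toDual ∘ b) := fun i j hij => hA i j hij
  have := A.invertible
  intro i j hij
  have h := Matrix.blockTriangular_inv_of_blockTriangular hA' (i := i) (j := j) hij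
  rwa [← Matrix.coe_units_inv] at h

/-- `A'` is the adjoint of `A` with respect to the forms `∑ ε j * x j ^ 2` on the diagonal blocks,
for block lower triangular matrices `A` and `A'`. -/
structure BlockAdj (b : Fin n → ℕ) (ε : Fin n → ℤˣ) (A A' : Matrix (Fin n) (Fin n) ℝ) : Prop where
  left : BlockLower b A
  right : BlockLower b A'
  adj : ∀ i j, b i = b j → A' i j = sgn (ε i) * sgn (ε j) * A j i

namespace BlockAdj

variable {b : Fin n → ℕ} {ε : Fin n → ℤˣ} {A A' B B' : Matrix (Fin n) (Fin n) ℝ}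

theorem mul (hA : BlockAdj b ε A A') (hB : BlockAdj b ε B B') :
    BlockAdj b ε (A * B) (B' * A') := by
  refine ⟨hA.left.mul hB.left, hB.right.mul hA.right, fun i j hij => ?_⟩
  rw [hB.right.mul_apply hA.right hij, hA.left.mul_apply hB.left hij.symm, Finset.mul_sum, ← hij]
  refine Finset.sum_congr rfl fun k hk => ?_
  have hk : b k = b i := (Finset.mem_filter.1 hk).2
  rw [hB.adj i k hk.symm, hA.adj k j (hk.trans hij)]
  linear_combination (sgn (ε i) * sgn (ε j) * A j k * B k i) * sgn_mul_self (ε k)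

theorem one : BlockAdj b ε 1 1 := by
  refine ⟨.one b, .one b, fun i j _ => ?_⟩
  by_cases h : i = j
  · subst h
    simp [sgn_mul_self]
  · simp [h, Ne.symm h]

theorem symm (hA : BlockAdj b ε A A') : BlockAdj b ε A' A := by
  refine ⟨hA.right, hA.left, fun i j hij => ?_⟩
  rw [hA.adj j i hij.symm]
  linear_combination (-(sgn (ε j) * sgn (ε j)) * A i j) * sgn_mul_self (ε i) -
    A i j * sgn_mul_self (ε j)

theorem exists_adj (hA : BlockLower b A) : ∃ A', BlockAdj b ε A A' := by
  refine ⟨Matrix.of fun i j => if b i = b j then sgn (ε i) * sgn (ε j) * A j i else 0,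
    hA, fun i j hij => ?_, fun i j hij => ?_⟩
  · simp [hij.ne]
  · simp [hij]

theorem eq_of_same (hA : BlockAdj b ε A A') (hA' : BlockAdj b ε A B') {i j : Fin n}
    (hij : b i = b j) : A' i j = B' i j := by
  rw [hA.adj i j hij, hA'.adj i j hij]

/-- A block adjoint is determined only on the diagonal blocks, so the inverse is compared there with
a chosen adjoint of `A⁻¹`. -/
theorem units_inv {A A' : GL (Fin n) ℝ} (h : BlockAdj b ε A.val A'.val) :
    BlockAdj b ε (A⁻¹).val (A'⁻¹).val := by
  refine ⟨h.left.units_inv, h.right.units_inv, fun i j hij => ?_⟩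
  obtain ⟨C, hC⟩ := exists_adj (ε := ε) h.left.units_inv
  -- Being an adjoint of 1, `C * A'` agrees with 1 on the diagonal blocks; multiplying by `A'⁻¹`
  -- then identifies the diagonal blocks of `C` and `A'⁻¹`.
  have h1 : BlockAdj b ε 1 (C * A'.val) := by
    have := h.mul hC
    rwa [Units.mul_inv] at this
  rw [← hC.adj i j hij]
  have h2 : C = C * A'.val * (A'⁻¹).val := by rw [mul_assoc, Units.mul_inv, mul_one]
  rw [h2, h1.right.mul_apply h.right.units_inv hij]
  have h3 : ∀ k, b k = b i → (C * A'.val) i k = (1 : Matrix (Fin n) (Fin n) ℝ) i k :=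
    fun k hk => h1.eq_of_same one hk.symm
  rw [Finset.sum_congr rfl fun k hk => by rw [h3 k (Finset.mem_filter.1 hk).2],
    ← (BlockLower.one b).mul_apply h.right.units_inv hij, one_mul]

end BlockAdj

/-- The group of invertible block lower triangular matrices whose diagonal blocks preserve the
forms `∑ ε j * x j ^ 2`. -/
def blockGroup (b : Fin n → ℕ) (ε : Fin n → ℤˣ) : Subgroup (GL (Fin n) ℝ) where
  carrier := {A | BlockAdj b ε A.val (A⁻¹).val}
  one_mem' := by
    simpa using BlockAdj.one
  mul_mem' := by
    intro A B hA hB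
    change BlockAdj b ε (A * B).val ((A * B)⁻¹).val
    rw [mul_inv_rev]
    exact BlockAdj.mul hA hB
  inv_mem' := by
    intro A hA
    change BlockAdj b ε (A⁻¹).val (A⁻¹⁻¹).val
    rw [inv_inv]
    exact BlockAdj.symm hA

theorem mem_blockGroup {b : Fin n → ℕ} {ε : Fin n → ℤˣ} {A : GL (Fin n) ℝ} :
    A ∈ blockGroup b ε ↔ BlockAdj b ε A.val (A⁻¹).val := Iff.rfl

theorem continuous_entry (i j : Fin n) : Continuous fun A : GL (Fin n) ℝ => A.val i j :=
  (Units.continuous_val.matrix_elem i j)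

theorem continuous_inv_entry (i j : Fin n) : Continuous fun A : GL (Fin n) ℝ => (A⁻¹).val i j :=
  (continuous_entry i j).comp continuous_inv

theorem isClosed_blockGroup (b : Fin n → ℕ) (ε : Fin n → ℤˣ) :
    IsClosed (blockGroup b ε : Set (GL (Fin n) ℝ)) := by
  have : (blockGroup b ε : Set (GL (Fin n) ℝ)) =
      {A | ∀ i j, (b i < b j → A.val i j = 0) ∧ (b i < b j → (A⁻¹).val i j = 0) ∧
        (b i = b j → (A⁻¹).val i j = sgn (ε i) * sgn (ε j) * A.val j i)} := by
    ext A
    exact ⟨fun h i j => ⟨h.left i j, h.right i j, h.adj i j⟩,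
      fun h => ⟨fun i j => (h i j).1, fun i j => (h i j).2.1, fun i j => (h i j).2.2⟩⟩
  rw [this]
  simp only [Set.ofPred_forall, Set.ofPred_and]
  have h1 := continuous_entry (n := n)
  have h2 := continuous_inv_entry (n := n)
  refine isClosed_iInter fun i => isClosed_iInter fun j => ?_
  refine (isClosed_iInter fun _ => ?_).inter ((isClosed_iInter fun _ => ?_).inter
    (isClosed_iInter fun _ => ?_))
  · exact isClosed_eq (h1 i j) continuous_const
  · exact isClosed_eq (h2 i j) continuous_const
  · exact isClosed_eq (h2 i j) (continuous_const.mul (h1 j i))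

/-- The diagonal blocks of a matrix. -/
def blockDiag' (b : Fin n → ℕ) (A : Matrix (Fin n) (Fin n) ℝ) : Matrix (Fin n) (Fin n) ℝ :=
  Matrix.of fun i j => if b i = b j then A i j else 0

theorem blockDiag'_mul {b : Fin n → ℕ} {A B : Matrix (Fin n) (Fin n) ℝ}
    (hA : BlockLower b A) (hB : BlockLower b B) :
    blockDiag' b A * blockDiag' b B = blockDiag' b (A * B) := by
  ext i j
  by_cases hij : b i = b j
  · simp only [blockDiag', Matrix.of_apply, if_pos hij]
    rw [hA.mul_apply hB hij, Matrix.mul_apply, Finset.sum_filter]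
    refine Finset.sum_congr rfl fun k _ => ?_
    by_cases hk : b k = b i
    · simp [hk, hij]
    · simp [hk, Ne.symm hk]
  · simp only [blockDiag', Matrix.of_apply, if_neg hij]
    rw [Matrix.mul_apply]
    refine Finset.sum_eq_zero fun k _ => ?_
    by_cases hk : b i = b k
    · simp [hk ▸ hij]
    · simp [hk]

theorem blockDiag'_one (b : Fin n → ℕ) : blockDiag' b 1 = 1 := by
  ext i j
  by_cases hij : i = j
  · subst hij
    simp [blockDiag']
  · simp [blockDiag', hij]

/-- The block diagonal part of an element of `blockGroup b ε`. -/
def levi (b : Fin n → ℕ) (ε : Fin n → ℤˣ) (A : GL (Fin n) ℝ) (hA : A ∈ blockGroup b ε) :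
    GL (Fin n) ℝ where
  val := blockDiag' b A.val
  inv := blockDiag' b (A⁻¹).val
  val_inv := by rw [blockDiag'_mul hA.left hA.right, Units.mul_inv, blockDiag'_one]
  inv_val := by rw [blockDiag'_mul hA.right hA.left, Units.inv_mul, blockDiag'_one]

theorem levi_val_apply {b : Fin n → ℕ} {ε : Fin n → ℤˣ} {A : GL (Fin n) ℝ}
    (hA : A ∈ blockGroup b ε) (i j : Fin n) :
    (levi b ε A hA).val i j = if b i = b j then A.val i j else 0 := rfl

theorem levi_inv_val_apply {b : Fin n → ℕ} {ε : Fin n → ℤˣ} {A : GL (Fin n) ℝ}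
    (hA : A ∈ blockGroup b ε) (i j : Fin n) :
    (levi b ε A hA)⁻¹.val i j = if b i = b j then (A⁻¹).val i j else 0 := rfl

theorem levi_mem {b b' : Fin n → ℕ} {ε : Fin n → ℤˣ} {A : GL (Fin n) ℝ}
    (hA : A ∈ blockGroup b ε) (hb : ∀ i j, b i = b j → b' i = b' j) :
    levi b ε A hA ∈ blockGroup b' ε := by
  refine ⟨fun i j hij => ?_, fun i j hij => ?_, fun i j hij => ?_⟩
  · rw [levi_val_apply, if_neg fun h => hij.ne (hb i j h)]
  · rw [levi_inv_val_apply, if_neg fun h => hij.ne (hb i j h)]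
  · rw [levi_val_apply, levi_inv_val_apply]
    by_cases h : b i = b j
    · rw [if_pos h, if_pos h.symm, hA.adj i j h]
    · rw [if_neg h, if_neg (Ne.symm h), mul_zero]

/-- Determinants only see diagonal blocks, and those of `A⁻¹` are the transposes of those of `A` up
to conjugation by signs. So `A⁻¹` and `A` have the same determinant, whose square is then 1. -/
theorem abs_det_of_mem_blockGroup {b : Fin n → ℕ} {ε : Fin n → ℤˣ} {A : GL (Fin n) ℝ}
    (hA : A ∈ blockGroup b ε) : |A.val.det| = 1 := by
  have key : ∀ M : Matrix (Fin n) (Fin n) ℝ, BlockLower b M → M.det = (blockDiag' b M).det := by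
    intro M hM
    have h1 : Matrix.BlockTriangular M (OrderDual.toDual ∘ b) := fun i j hij => hM i j hij
    have h2 : Matrix.BlockTriangular (blockDiag' b M) (OrderDual.toDual ∘ b) := fun i j hij => by
      have : b i < b j := hij
      simp [blockDiag', this.ne]
    rw [h1.det, h2.det]
    refine Finset.prod_congr rfl fun k _ => ?_
    congr 1
    ext ⟨i, hi⟩ ⟨j, hj⟩
    have : b i = b j := OrderDual.toDual.injective (hi.trans hj.symm)
    simp [Matrix.toSquareBlock_def, blockDiag', this]
  have h3 : blockDiag' b (A⁻¹).val = Matrix.diagonal (fun i => sgn (ε i)) *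
      (blockDiag' b A.val).transpose * Matrix.diagonal (fun i => sgn (ε i)) := by
    ext i j
    rw [Matrix.mul_diagonal, Matrix.diagonal_mul, Matrix.transpose_apply]
    by_cases h : b i = b j
    · simp only [blockDiag', Matrix.of_apply, if_pos h, if_pos h.symm, hA.adj i j h]
      ring
    · simp [blockDiag', h, Ne.symm h]
  have h4 : (Matrix.diagonal fun i => sgn (ε i)).det * (Matrix.diagonal fun i => sgn (ε i)).det
      = 1 := by
    rw [← Matrix.det_mul, Matrix.diagonal_mul_diagonal]
    simp [sgn_mul_self]
  have h5 : (A⁻¹).val.det = A.val.det := by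
    rw [key _ hA.right, h3, Matrix.det_mul, Matrix.det_mul, Matrix.det_transpose, key _ hA.left]
    linear_combination (blockDiag' b A.val).det * h4
  have h6 : A.val.det * A.val.det = 1 := by
    nth_rw 2 [← h5]
    rw [← Matrix.det_mul, Units.mul_inv, Matrix.det_one]
  rcases mul_self_eq_one_iff.1 h6 with h | h <;> simp [h]

end BlockGroups

/-! ### Limits under diagonal conjugation -/

section DiagonalLimits

variable {n : ℕ}

/-- The invertible diagonal matrix with given entries. -/
def diagGL (t : Fin n → ℝˣ) : GL (Fin n) ℝ where
  val := Matrix.diagonal fun i => (t i : ℝ)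
  inv := Matrix.diagonal fun i => ((t i)⁻¹ : ℝˣ).val
  val_inv := by rw [Matrix.diagonal_mul_diagonal]; simp
  inv_val := by rw [Matrix.diagonal_mul_diagonal]; simp

theorem diagGL_val (t : Fin n → ℝˣ) : (diagGL t).val = Matrix.diagonal fun i => (t i : ℝ) := rfl

theorem diagGL_inv (t : Fin n → ℝˣ) : (diagGL t)⁻¹ = diagGL t⁻¹ := Units.ext rfl

theorem diagGL_mul (s t : Fin n → ℝˣ) : diagGL s * diagGL t = diagGL (s * t) :=
  Units.ext (by simp [diagGL_val])

theorem diagGL_conj_apply (t : Fin n → ℝˣ) (A : GL (Fin n) ℝ) (i j : Fin n) :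
    ((diagGL t)⁻¹ * A * diagGL t).val i j = (t j : ℝ) / t i * A.val i j := by
  rw [diagGL_inv, Units.val_mul, Units.val_mul, diagGL_val, diagGL_val, Matrix.mul_diagonal,
    Matrix.diagonal_mul]
  simp [div_eq_mul_inv]
  ring

/-- Forward substitution, by strong induction on the block number, shows that the kernel is trivial.
-/
theorem BlockLower.isUnit_of_diag {b : Fin n → ℕ} {M : Matrix (Fin n) (Fin n) ℝ} {c : ℝ}
    (hc : c ≠ 0) (hM : ∀ i j, b i ≤ b j → M i j = if i = j then c else 0) : IsUnit M := by
  rw [← Matrix.mulVec_injective_iff_isUnit]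
  refine (injective_iff_map_eq_zero (Matrix.mulVecLin M)).2 fun x hx => ?_
  have key : ∀ k, ∀ i, b i = k → x i = 0 := by
    intro k
    induction k using Nat.strong_induction_on with
    | _ k ih =>
      intro i hi
      have h : ∑ j, M i j * x j = 0 := congrFun hx i
      rw [Finset.sum_eq_single i] at h
      · rw [hM i i le_rfl, if_pos rfl] at h
        exact (mul_eq_zero.1 h).resolve_left hc
      · intro j _ hji
        rcases le_or_gt (b i) (b j) with hij | hij
        · rw [hM i j hij, if_neg (Ne.symm hji), zero_mul]
        · rw [ih (b j) (hi ▸ hij) j rfl, mul_zero]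
      · simp
  exact funext fun i => key _ i rfl

/-- The Cayley transform: a block unipotent matrix `U` is `(1 + N) (1 - N)⁻¹` for a strictly block
lower triangular matrix `N`. -/
theorem exists_cayley {b : Fin n → ℕ} {U : Matrix (Fin n) (Fin n) ℝ}
    (hU : ∀ i j, b i ≤ b j → U i j = if i = j then 1 else 0) :
    ∃ N : Matrix (Fin n) (Fin n) ℝ, (∀ i j, b i ≤ b j → N i j = 0) ∧ U * (1 - N) = 1 + N := by
  have hV : ∀ i j, b i ≤ b j → (U + 1) i j = if i = j then 2 else 0 := by
    intro i j hij
    rw [Matrix.add_apply, hU i j hij, Matrix.one_apply]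
    split_ifs <;> norm_num
  obtain ⟨V, hVU⟩ := BlockLower.isUnit_of_diag two_ne_zero hV
  refine ⟨(V⁻¹).val * (U - 1), ?_, ?_⟩
  · have hN : (U + 1) * ((V⁻¹).val * (U - 1)) = U - 1 := by
      rw [← hVU, ← mul_assoc, Units.mul_inv, one_mul]
    generalize (V⁻¹).val * (U - 1) = N at hN
    have key : ∀ k, ∀ i j, b i = k → b i ≤ b j → N i j = 0 := by
      intro k
      induction k using Nat.strong_induction_on with
      | _ k ih =>
        intro i j hi hij
        have h : ∑ k, (U + 1) i k * N k j = (U - 1) i j := by rw [← hN, Matrix.mul_apply]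
        rw [Matrix.sub_apply, hU i j hij, Matrix.one_apply, sub_self, Finset.sum_eq_single i] at h
        · rw [hV i i le_rfl, if_pos rfl] at h
          exact (mul_eq_zero.1 h).resolve_left two_ne_zero
        · intro k _ hki
          rcases le_or_gt (b i) (b k) with hik | hik
          · rw [hV i k hik, if_neg (Ne.symm hki), zero_mul]
          · rw [ih (b k) (hi ▸ hik) k j rfl (hik.le.trans hij), mul_zero]
        · simp
    exact fun i j => key _ i j rfl
  · have h1 : (V⁻¹).val * (U + 1) = 1 := by rw [← hVU, Units.inv_mul]
    have h2 : (U + 1) * (V⁻¹).val = 1 := by rw [← hVU, Units.mul_inv]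
    have h3 : (U + 1) * ((V⁻¹).val * (U - 1)) = U - 1 := by rw [← mul_assoc, h2, one_mul]
    generalize (V⁻¹).val * (U - 1) = N at h3
    rw [add_mul, one_mul] at h3
    rw [mul_sub, mul_one, sub_eq_iff_eq_add, add_assoc, add_comm N, h3]
    abel

theorem exists_tendsto_GL {ι : Type*} {l : Filter ι} {M : ι → Matrix (Fin n) (Fin n) ℝ}
    {u : GL (Fin n) ℝ} (h : Tendsto M l (𝓝 u.val)) :
    ∃ f : ι → GL (Fin n) ℝ, Tendsto f l (𝓝 u) ∧ ∀ᶠ k in l, (f k).val = M k := by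
  let _ := Matrix.linftyOpNormedRing (n := Fin n) (α := ℝ)
  let _ := Matrix.linftyOpNormedAlgebra (n := Fin n) (α := ℝ) (R := ℝ)
  have : CompleteSpace (Matrix (Fin n) (Fin n) ℝ) := FiniteDimensional.complete ℝ _
  exact exists_tendsto_units h

variable {ι : Type*} {l : Filter ι} {b b' : Fin n → ℕ} {ε : Fin n → ℤˣ} {t : ι → Fin n → ℝˣ}

/-- The factor `(t i / t j) ^ 2` drives the degeneration: the adjoint relation persists where the
scales agree and forces a zero where the ratio tends to 0. -/
theorem inv_apply_of_conj_mem {t : Fin n → ℝˣ} {A : GL (Fin n) ℝ}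
    (hA : A ∈ (blockGroup b ε).map (MulAut.conj (diagGL t)).toMonoidHom) {i j : Fin n}
    (hij : b i = b j) :
    (A⁻¹).val i j = sgn (ε i) * sgn (ε j) * ((t i : ℝ) / t j * (t i / t j)) * A.val j i := by
  rw [mem_map_conj_iff] at hA
  have h := hA.adj i j hij
  have e : ((diagGL t)⁻¹ * A * diagGL t)⁻¹ = (diagGL t)⁻¹ * A⁻¹ * diagGL t := by group
  rw [e, diagGL_conj_apply, diagGL_conj_apply] at h
  have hi := (t i).ne_zero
  have hj := (t j).ne_zero
  field_simp at h ⊢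
  linear_combination h

theorem apply_eq_zero_of_conj_mem {t : Fin n → ℝˣ} {A : GL (Fin n) ℝ}
    (hA : A ∈ (blockGroup b ε).map (MulAut.conj (diagGL t)).toMonoidHom) {i j : Fin n}
    (hij : b i < b j) : A.val i j = 0 := by
  rw [mem_map_conj_iff] at hA
  have h := hA.left i j hij
  rw [diagGL_conj_apply] at h
  exact (mul_eq_zero.1 h).resolve_left (div_ne_zero (t j).ne_zero (t i).ne_zero)

theorem blockLower_of_tendsto [l.NeBot]
    (h1 : ∀ i j, b j < b i → b' j < b' i)
    (h3 : ∀ i j, b i = b j → b' i < b' j → Tendsto (fun k => (t k i : ℝ) / t k j) l (𝓝 0))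
    {h : ι → GL (Fin n) ℝ} {B : GL (Fin n) ℝ} (hB : Tendsto h l (𝓝 B))
    (hh : ∀ᶠ k in l, h k ∈ (blockGroup b ε).map (MulAut.conj (diagGL (t k))).toMonoidHom) :
    BlockLower b' B.val := by
  intro i j hij
  have hlim : Tendsto (fun k => (h k).val i j) l (𝓝 (B.val i j)) :=
    ((continuous_entry i j).tendsto B).comp hB
  refine tendsto_nhds_unique hlim ?_
  rcases lt_trichotomy (b i) (b j) with hb | hb | hb
  · refine tendsto_const_nhds.congr' ?_
    filter_upwards [hh] with k hk
    rw [apply_eq_zero_of_conj_mem hk hb]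
  -- Inside one coarse block the entry is the squared ratio times an entry of the inverse; the
  -- latter converges, so the product tends to 0.
  · have hlim' : Tendsto (fun k => ((h k)⁻¹).val j i) l (𝓝 ((B⁻¹).val j i)) :=
      ((continuous_inv_entry j i).tendsto B).comp hB
    have := ((((h3 i j hb hij).mul (h3 i j hb hij)).const_mul (sgn (ε i) * sgn (ε j))).mul hlim')
    simp only [mul_zero, zero_mul] at this
    refine this.congr' ?_
    filter_upwards [hh] with k hk
    rw [← inv_apply_of_conj_mem (inv_mem hk) hb, inv_inv]
  · exact absurd (h1 i j hb) (not_lt.2 hij.le)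

theorem mem_blockGroup_of_tendsto [l.NeBot]
    (h1 : ∀ i j, b i < b j → b' i < b' j)
    (h2 : ∀ i j, b' i = b' j → ∀ k, t k i = t k j)
    (h3 : ∀ i j, b i = b j → b' i < b' j → Tendsto (fun k => (t k i : ℝ) / t k j) l (𝓝 0))
    {h : ι → GL (Fin n) ℝ} {B : GL (Fin n) ℝ} (hB : Tendsto h l (𝓝 B))
    (hh : ∀ᶠ k in l, h k ∈ (blockGroup b ε).map (MulAut.conj (diagGL (t k))).toMonoidHom) :
    B ∈ blockGroup b' ε := by
  refine ⟨blockLower_of_tendsto (fun i j => h1 j i) h3 hB hh,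
    blockLower_of_tendsto (fun i j => h1 j i) h3 hB.inv (hh.mono fun k hk => inv_mem hk),
    fun i j hij => ?_⟩
  have hb : b i = b j := by
    rcases lt_trichotomy (b i) (b j) with hb | hb | hb
    · exact absurd (h1 i j hb) (by omega)
    · exact hb
    · exact absurd (h1 j i hb) (by omega)
  have hlim : Tendsto (fun k => (h k).val j i) l (𝓝 (B.val j i)) :=
    ((continuous_entry j i).tendsto B).comp hB
  have hlim' : Tendsto (fun k => ((h k)⁻¹).val i j) l (𝓝 ((B⁻¹).val i j)) :=
    ((continuous_inv_entry i j).tendsto B).comp hB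
  refine tendsto_nhds_unique hlim' ((hlim.const_mul _).congr' ?_)
  filter_upwards [hh] with k hk
  rw [inv_apply_of_conj_mem hk hb, h2 i j hij k, div_self (t k j).ne_zero, mul_one, mul_one]

/-- If `Y` is skew for the forms of `blockGroup b ε`, then the quotients of `1 + Y` and `1 - Y`
are in `blockGroup b ε`. -/
theorem mul_inv_mem_blockGroup {Y : Matrix (Fin n) (Fin n) ℝ} {P Q : GL (Fin n) ℝ}
    (hY : BlockLower b Y) (hskew : ∀ i j, b i = b j → Y i j = -(sgn (ε i) * sgn (ε j) * Y j i))
    (hP : P.val = 1 + Y) (hQ : Q.val = 1 - Y) : P * Q⁻¹ ∈ blockGroup b ε := by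
  have hPQ : BlockAdj b ε P.val Q.val := by
    rw [hP, hQ]
    refine ⟨fun i j hij => ?_, fun i j hij => ?_, fun i j hij => ?_⟩
    · simp [BlockLower.one b i j hij, hY i j hij]
    · simp [BlockLower.one b i j hij, hY i j hij]
    · have := (BlockAdj.one (b := b) (ε := ε)).adj i j hij
      simp only [Matrix.sub_apply, Matrix.add_apply]
      rw [hskew i j hij]
      linear_combination this
  have hcomm : Commute P Q := by
    apply Units.ext
    simp only [Units.val_mul, hP, hQ]
    noncomm_ring
  have e : (P * Q⁻¹)⁻¹ = P⁻¹ * Q := by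
    rw [mul_inv_rev, inv_inv, hcomm.inv_left.eq]
  rw [mem_blockGroup, e]
  exact hPQ.mul hPQ.symm.units_inv

/-- `X` is required to be skew for the rescaled forms preserved by the conjugated group; conjugating
back reduces to `mul_inv_mem_blockGroup`. -/
theorem conj_mul_inv_mem {t : Fin n → ℝˣ} {X : Matrix (Fin n) (Fin n) ℝ} {P Q : GL (Fin n) ℝ}
    (hX : BlockLower b X)
    (hskew : ∀ i j, b i = b j →
      X i j = -(sgn (ε i) * sgn (ε j) * ((t i : ℝ) / t j * (t i / t j)) * X j i))
    (hP : P.val = 1 + X) (hQ : Q.val = 1 - X) :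
    P * Q⁻¹ ∈ (blockGroup b ε).map (MulAut.conj (diagGL t)).toMonoidHom := by
  rw [mem_map_conj_iff]
  have e : (diagGL t)⁻¹ * (P * Q⁻¹) * diagGL t =
      ((diagGL t)⁻¹ * P * diagGL t) * ((diagGL t)⁻¹ * Q * diagGL t)⁻¹ := by group
  rw [e]
  have hone : ∀ i j, (t j : ℝ) / t i * (1 : Matrix (Fin n) (Fin n) ℝ) i j =
      (1 : Matrix (Fin n) (Fin n) ℝ) i j := by
    intro i j
    by_cases h : i = j
    · subst h
      simp
    · simp [h]
  refine mul_inv_mem_blockGroup (Y := Matrix.of fun i j => (t j : ℝ) / t i * X i j)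
    (fun i j hij => ?_) (fun i j hij => ?_) ?_ ?_
  · simp [hX i j hij]
  · simp only [Matrix.of_apply]
    rw [hskew i j hij]
    have hi := (t i).ne_zero
    have hj := (t j).ne_zero
    field_simp
  · ext i j
    rw [diagGL_conj_apply, hP, Matrix.add_apply, mul_add, hone]
    rfl
  · ext i j
    rw [diagGL_conj_apply, hQ, Matrix.sub_apply, mul_sub, hone]
    rfl

/-- Write `B` as its block diagonal part times a block unipotent factor. The first commutes with
every `diagGL (t k)` and so lies in all the conjugates. The second is the Cayley transform of a
strictly block lower `N`, and `N` is approximated by skew parameters of the conjugated groups. -/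
theorem exists_tendsto_of_mem_blockGroup
    (h1 : ∀ i j, b i < b j → b' i < b' j)
    (h2 : ∀ i j, b' i = b' j → ∀ k, t k i = t k j)
    (h3 : ∀ i j, b i = b j → b' i < b' j → Tendsto (fun k => (t k i : ℝ) / t k j) l (𝓝 0))
    {B : GL (Fin n) ℝ} (hB : B ∈ blockGroup b' ε) :
    ∃ h : ι → GL (Fin n) ℝ,
      (∀ᶠ k in l, h k ∈ (blockGroup b ε).map (MulAut.conj (diagGL (t k))).toMonoidHom) ∧
      Tendsto h l (𝓝 B) := by
  have hbb : ∀ i j, b' i = b' j → b i = b j := by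
    intro i j hij
    rcases lt_trichotomy (b i) (b j) with hb | hb | hb
    · exact absurd (h1 i j hb) (by omega)
    · exact hb
    · exact absurd (h1 j i hb) (by omega)
  set P := levi b' ε B hB with hPdef
  have hPmem : ∀ k, P ∈ (blockGroup b ε).map (MulAut.conj (diagGL (t k))).toMonoidHom := by
    intro k
    rw [mem_map_conj_iff]
    have : (diagGL (t k))⁻¹ * P * diagGL (t k) = P := by
      apply Units.ext
      ext i j
      rw [diagGL_conj_apply, levi_val_apply]
      split_ifs with hij
      · rw [h2 i j hij k, div_self (t k j).ne_zero, one_mul]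
      · rw [mul_zero]
    rw [this]
    exact levi_mem hB hbb
  have hU : ∀ i j, b' i ≤ b' j → (P⁻¹ * B).val i j = if i = j then 1 else 0 := by
    have hm : P⁻¹ * B ∈ blockGroup b' ε := mul_mem (inv_mem (levi_mem hB fun i j h => h)) hB
    intro i j hij
    rcases hij.lt_or_eq with hij | hij
    · rw [hm.left i j hij, if_neg]
      rintro rfl
      exact lt_irrefl _ hij
    · rw [Units.val_mul,
        BlockLower.mul_apply (levi_mem hB fun i j h => h : P ∈ blockGroup b' ε).right hB.left hij,
        ← Matrix.one_apply, ← Units.inv_mul B, BlockLower.mul_apply hB.right hB.left hij]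
      refine Finset.sum_congr rfl fun k hk => ?_
      rw [levi_inv_val_apply, if_pos (Finset.mem_filter.1 hk).2.symm]
  obtain ⟨N, hN0, hN⟩ := exists_cayley hU
  -- Subtracting from `N` its adjoint for the rescaled forms makes it skew on the coarse blocks. The
  -- correction vanishes in the limit: `N j i` is nonzero only if `b' i < b' j`, and then `t k i / t
  -- k j` tends to 0.
  set X : ι → Matrix (Fin n) (Fin n) ℝ := fun k => Matrix.of fun i j => N i j -
    if b i = b j then sgn (ε i) * sgn (ε j) * ((t k i : ℝ) / t k j * (t k i / t k j)) * N j i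
      else 0 with hXdef
  have hX : Tendsto X l (𝓝 N) := by
    refine tendsto_pi_nhds.2 fun i => tendsto_pi_nhds.2 fun j => ?_
    simp only [hXdef, Matrix.of_apply]
    suffices h0 : Tendsto (fun k => if b i = b j then
        sgn (ε i) * sgn (ε j) * ((t k i : ℝ) / t k j * (t k i / t k j)) * N j i else 0) l (𝓝 0) by
      simpa using (tendsto_const_nhds (x := N i j)).sub h0
    split_ifs with hb
    · rcases le_or_gt (b' j) (b' i) with hij | hij
      · simp only [hN0 j i hij, mul_zero]
        exact tendsto_const_nhds
      · have := (((h3 i j hb hij).mul (h3 i j hb hij)).const_mul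
          (sgn (ε i) * sgn (ε j))).mul_const (N j i)
        simpa using this
    · exact tendsto_const_nhds
  obtain ⟨p, hp⟩ : IsUnit (1 + N) := BlockLower.isUnit_of_diag (b := b') one_ne_zero
    fun i j hij => by rw [Matrix.add_apply, hN0 i j hij, add_zero, Matrix.one_apply]
  obtain ⟨q, hq⟩ : IsUnit (1 - N) := BlockLower.isUnit_of_diag (b := b') one_ne_zero
    fun i j hij => by rw [Matrix.sub_apply, hN0 i j hij, sub_zero, Matrix.one_apply]
  obtain ⟨f, hf, hf'⟩ := exists_tendsto_GL (M := fun k => 1 + X k) (u := p) (l := l)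
    (by rw [hp]; exact tendsto_const_nhds.add hX)
  obtain ⟨g, hg, hg'⟩ := exists_tendsto_GL (M := fun k => 1 - X k) (u := q) (l := l)
    (by rw [hq]; exact tendsto_const_nhds.sub hX)
  refine ⟨fun k => P * (f k * (g k)⁻¹), ?_, ?_⟩
  · filter_upwards [hf', hg'] with k hfk hgk
    refine mul_mem (hPmem k) (conj_mul_inv_mem (X := X k) (fun i j hij => ?_)
      (fun i j hij => ?_) hfk hgk)
    · simp only [hXdef, Matrix.of_apply, if_neg hij.ne, sub_zero]
      exact hN0 i j (h1 i j hij).le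
    · simp only [hXdef, Matrix.of_apply, if_pos hij, if_pos hij.symm]
      have hi := (t k i).ne_zero
      have hj := (t k j).ne_zero
      have e1 := sgn_mul_self (ε i)
      have e2 := sgn_mul_self (ε j)
      have e3 : (t k i : ℝ) / t k j * (t k j / t k i) = 1 := by field_simp
      generalize (t k i : ℝ) / t k j = u at *
      generalize (t k j : ℝ) / t k i = v at *
      linear_combination (-N i j) * e1 + (-N i j * (sgn (ε i) * sgn (ε i))) * e2 +
        (-N i j * (sgn (ε i) * sgn (ε i)) * (sgn (ε j) * sgn (ε j)) * (1 + u * v)) * e3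
  · have e : B = P * (p * q⁻¹) := by
      have : P⁻¹ * B = p * q⁻¹ := by
        rw [eq_mul_inv_iff_mul_eq]
        apply Units.ext
        rw [Units.val_mul, hq, hp, hN]
      rw [← this, mul_inv_cancel_left]
    rw [e]
    exact tendsto_const_nhds.mul (hf.mul hg.inv)

theorem filterLim_diagGL [l.NeBot]
    (h1 : ∀ i j, b i < b j → b' i < b' j)
    (h2 : ∀ i j, b' i = b' j → ∀ k, t k i = t k j)
    (h3 : ∀ i j, b i = b j → b' i < b' j → Tendsto (fun k => (t k i : ℝ) / t k j) l (𝓝 0)) :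
    FilterLim l (fun k => (blockGroup b ε).map (MulAut.conj (diagGL (t k))).toMonoidHom)
      (blockGroup b' ε) := fun _ =>
  ⟨exists_tendsto_of_mem_blockGroup h1 h2 h3,
    fun ⟨_, hh, hB⟩ => mem_blockGroup_of_tendsto h1 h2 h3 hB hh⟩

end DiagonalLimits

/-! ### Adapted bases and the standard form of the isometry group -/

section AdaptedBases

variable {n m : ℕ} {F : PartialFlag n m}

theorem glEquiv_mul (g h : GL (Fin n) ℝ) (x : Fin n → ℝ) :
    glEquiv (g * h) x = glEquiv g (glEquiv h x) := by
  simp [glEquiv_apply]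

theorem glEquiv_one (x : Fin n → ℝ) : glEquiv 1 x = x := by simp [glEquiv_apply]

theorem glEquiv_inv_apply (g : GL (Fin n) ℝ) (x : Fin n → ℝ) :
    glEquiv g⁻¹ (glEquiv g x) = x := by
  rw [← glEquiv_mul, inv_mul_cancel, glEquiv_one]

theorem glEquiv_apply_inv (g : GL (Fin n) ℝ) (x : Fin n → ℝ) :
    glEquiv g (glEquiv g⁻¹ x) = x := by
  rw [← glEquiv_mul, mul_inv_cancel, glEquiv_one]

theorem glEquiv_single (g : GL (Fin n) ℝ) (j i : Fin n) :
    glEquiv g (Pi.single j 1) i = g.val i j := by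
  rw [glEquiv_apply, Matrix.mulVec_single_one]
  rfl

/-- The columns of `g` are a basis adapted to the flag of `β` in which every form of `β` is a signed
sum of squares: the column `j` belongs to the piece `b j` and has square `ε j`. -/
structure Adapted (β : FlagForms F) (g : GL (Fin n) ℝ) (b : Fin n → ℕ) (ε : Fin n → ℤˣ) :
    Prop where
  lt : ∀ j, b j < m
  mem_iff : ∀ (k : Fin (m + 1)) (x : Fin n → ℝ),
    glEquiv g x ∈ F.V k ↔ ∀ j, b j < k → x j = 0
  form_eq : ∀ (k : Fin m) (x : Fin n → ℝ) (hx : glEquiv g x ∈ F.V k.castSucc),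
    β.form k (F.toPiece k ⟨_, hx⟩) = ∑ j with b j = k, sgn (ε j) * (x j * x j)

theorem BlockLower.glEquiv_apply_eq_zero {b : Fin n → ℕ} {A : GL (Fin n) ℝ}
    (hA : BlockLower b A.val) {k : ℕ} {x : Fin n → ℝ} (hx : ∀ j, b j < k → x j = 0) (i : Fin n)
    (hi : b i < k) : glEquiv A x i = 0 := by
  change ∑ j, A.val i j * x j = 0
  refine Finset.sum_eq_zero fun j _ => ?_
  rcases lt_or_ge (b j) k with hj | hj
  · rw [hx j hj, mul_zero]
  · rw [hA i j (hi.trans_le hj), zero_mul]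

namespace Adapted

variable {β : FlagForms F} {g : GL (Fin n) ℝ} {b : Fin n → ℕ} {ε : Fin n → ℤˣ}

theorem mem_iff' (ha : Adapted β g b ε) (k : Fin (m + 1)) (x : Fin n → ℝ) :
    x ∈ F.V k ↔ ∀ j, b j < k → glEquiv g⁻¹ x j = 0 := by
  rw [← ha.mem_iff, glEquiv_apply_inv]

/-- The flag descends strictly, so no piece is zero. -/
theorem surj (ha : Adapted β g b ε) (k : Fin m) : ∃ j, b j = k := by
  obtain ⟨x, hx, hx'⟩ := Set.exists_of_ssubset (F.strictAnti k.castSucc_lt_succ)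
  rw [SetLike.mem_coe, ha.mem_iff'] at hx hx'
  push Not at hx'
  obtain ⟨j, hj, hj'⟩ := hx'
  refine ⟨j, le_antisymm (Nat.lt_succ_iff.1 hj) (not_lt.1 fun h => hj' (hx j h))⟩

theorem single_mem (ha : Adapted β g b ε) {k : Fin (m + 1)} {j : Fin n} (hj : k ≤ b j) :
    glEquiv g (Pi.single j 1) ∈ F.V k := by
  rw [ha.mem_iff]
  intro i hi
  rw [Pi.single_apply, if_neg]
  rintro rfl
  omega

theorem conj_apply (g h : GL (Fin n) ℝ) (x : Fin n → ℝ) :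
    glEquiv h (glEquiv g x) = glEquiv g (glEquiv (g⁻¹ * h * g) x) := by
  simp only [← glEquiv_mul]
  congr 2
  group

theorem blockLower_conj (ha : Adapted β g b ε) {h : GL (Fin n) ℝ}
    (hh : ∀ k, (F.V k).map (glEquiv h).toLinearMap = F.V k) :
    BlockLower b (g⁻¹ * h * g).val := by
  intro i j hij
  have h1 : glEquiv g (Pi.single j 1) ∈ F.V ⟨b j, (ha.lt j).trans (Nat.lt_succ_self m)⟩ :=
    ha.single_mem le_rfl
  have h2 : glEquiv h (glEquiv g (Pi.single j 1)) ∈ _ :=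
    (hh _).le (Submodule.mem_map_of_mem h1)
  rw [conj_apply, ha.mem_iff] at h2
  rw [← glEquiv_single]
  exact h2 i hij

theorem map_le_of_blockLower (ha : Adapted β g b ε) {h : GL (Fin n) ℝ}
    (hA : BlockLower b (g⁻¹ * h * g).val) (k : Fin (m + 1)) :
    (F.V k).map (glEquiv h).toLinearMap ≤ F.V k := by
  rintro _ ⟨x, hx, rfl⟩
  obtain ⟨y, rfl⟩ : ∃ y, x = glEquiv g y := ⟨_, (glEquiv_apply_inv g x).symm⟩
  have hy := (ha.mem_iff k y).1 hx
  change glEquiv h (glEquiv g y) ∈ F.V k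
  rw [conj_apply, ha.mem_iff]
  exact hA.glEquiv_apply_eq_zero hy

theorem map_eq_inv {h : GL (Fin n) ℝ} {W : Submodule ℝ (Fin n → ℝ)}
    (hh : W.map (glEquiv h).toLinearMap = W) : W.map (glEquiv h⁻¹).toLinearMap = W := by
  conv_lhs => rw [← hh]
  rw [← Submodule.map_comp]
  have : (glEquiv h⁻¹).toLinearMap ∘ₗ (glEquiv h).toLinearMap = LinearMap.id :=
    LinearMap.ext fun x => glEquiv_inv_apply h x
  rw [this, Submodule.map_id]

theorem mem_isom_of_mem (ha : Adapted β g b ε) {h : GL (Fin n) ℝ}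
    (hA : g⁻¹ * h * g ∈ blockGroup b ε) : h ∈ β.isom := by
  have hinv : (g⁻¹ * h * g)⁻¹ = g⁻¹ * h⁻¹ * g := by group
  refine ⟨fun k => le_antisymm (ha.map_le_of_blockLower hA.left k) ?_, fun k x y hxy => ?_⟩
  · have h1 := ha.map_le_of_blockLower (h := h⁻¹) (hinv ▸ hA.right) k
    intro x hx
    exact ⟨glEquiv h⁻¹ x, h1 (Submodule.mem_map_of_mem hx), glEquiv_apply_inv h x⟩
  · obtain ⟨x, hx⟩ := x
    obtain ⟨y, hy⟩ := y
    dsimp only at hxy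
    obtain ⟨v, rfl⟩ : ∃ v, x = glEquiv g v := ⟨_, (glEquiv_apply_inv g x).symm⟩
    have hyx : y = glEquiv g (glEquiv (g⁻¹ * h * g) v) := by rw [hxy, conj_apply]
    subst hyx
    rw [ha.form_eq k v hx, ha.form_eq k _ hy]
    rw [ha.mem_iff] at hx
    generalize g⁻¹ * h * g = A at hA
    have hv : ∀ i, b i = k → glEquiv A v i = ∑ j with b j = k, A.val i j * v j := by
      intro i hi
      rw [Finset.sum_filter]
      change ∑ j, A.val i j * v j = _
      refine Finset.sum_congr rfl fun j _ => ?_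
      split_ifs with hj
      · rfl
      · rcases lt_or_gt_of_ne hj with h | h
        · rw [hx j h, mul_zero]
        · rw [hA.left i j (hi ▸ h), zero_mul]
    -- On the block `k` the relation `A⁻¹ * A = 1`, with `A⁻¹` the signed adjoint of `A`, says that
    -- the columns of `A` are orthonormal for the form.
    have horth : ∀ j l, b j = k → b l = k →
        ∑ i with b i = k, sgn (ε i) * (A.val i j * A.val i l) = if j = l then sgn (ε j) else 0 := by
      intro j l hj hl
      have h1 := hA.right.mul_apply hA.left (hj.trans hl.symm)
      rw [Units.inv_mul, Matrix.one_apply, hj] at h1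
      have h2 : (if j = l then sgn (ε j) else 0) = sgn (ε j) * if j = l then 1 else 0 := by simp
      rw [h2, h1, Finset.mul_sum]
      refine Finset.sum_congr rfl fun i hi => ?_
      rw [hA.adj j i (hj.trans (Finset.mem_filter.1 hi).2.symm)]
      linear_combination (-sgn (ε i) * A.val i j * A.val i l) * sgn_mul_self (ε j)
    calc ∑ i with b i = k, sgn (ε i) * (glEquiv A v i * glEquiv A v i)
        = ∑ i with b i = k, ∑ j with b j = k, ∑ l with b l = k,
            sgn (ε i) * (A.val i j * A.val i l) * (v j * v l) := by
          refine Finset.sum_congr rfl fun i hi => ?_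
          rw [hv i (Finset.mem_filter.1 hi).2, Finset.sum_mul_sum, Finset.mul_sum]
          refine Finset.sum_congr rfl fun j _ => ?_
          rw [Finset.mul_sum]
          refine Finset.sum_congr rfl fun l _ => ?_
          ring
      _ = ∑ j with b j = k, ∑ l with b l = k, (if j = l then sgn (ε j) else 0) * (v j * v l) := by
          rw [Finset.sum_comm]
          refine Finset.sum_congr rfl fun j hj => ?_
          rw [Finset.sum_comm]
          refine Finset.sum_congr rfl fun l hl => ?_
          rw [← Finset.sum_mul, horth j l (Finset.mem_filter.1 hj).2 (Finset.mem_filter.1 hl).2]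
      _ = ∑ j with b j = k, sgn (ε j) * (v j * v j) := by
          refine Finset.sum_congr rfl fun j hj => ?_
          rw [Finset.sum_eq_single_of_mem j hj]
          · rw [if_pos rfl]
          · intro l _ hlj
            rw [if_neg (Ne.symm hlj), zero_mul]

theorem mem_of_mem_isom (ha : Adapted β g b ε) {h : GL (Fin n) ℝ} (hh : h ∈ β.isom) :
    g⁻¹ * h * g ∈ blockGroup b ε := by
  have hinv : (g⁻¹ * h * g)⁻¹ = g⁻¹ * h⁻¹ * g := by group
  have hL := ha.blockLower_conj hh.1
  have hR := ha.blockLower_conj (h := h⁻¹) fun k => map_eq_inv (hh.1 k)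
  refine ⟨hL, hinv ▸ hR, fun j l hjl => ?_⟩
  have hk : b j < m := ha.lt j
  have hq : ∀ v : Fin n → ℝ, (∀ i, b i < b j → v i = 0) →
      ∑ i with b i = b j, sgn (ε i) *
        (glEquiv (g⁻¹ * h * g) v i * glEquiv (g⁻¹ * h * g) v i) =
      ∑ i with b i = b j, sgn (ε i) * (v i * v i) := by
    intro v hv
    have hx : glEquiv g v ∈ F.V (Fin.castSucc ⟨b j, hk⟩) := (ha.mem_iff _ v).2 hv
    have hy : glEquiv g (glEquiv (g⁻¹ * h * g) v) ∈ F.V (Fin.castSucc ⟨b j, hk⟩) :=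
      (ha.mem_iff _ _).2 (hL.glEquiv_apply_eq_zero hv)
    have := hh.2 ⟨b j, hk⟩ ⟨_, hx⟩ ⟨_, hy⟩ (conj_apply g h v).symm
    rwa [ha.form_eq, ha.form_eq] at this
  rw [← hinv] at hR
  generalize g⁻¹ * h * g = A at *
  have hx : ∀ i, b i < b j → (Pi.single j 1 : Fin n → ℝ) i = 0 := by
    intro i hi
    rw [Pi.single_apply, if_neg]
    rintro rfl
    exact lt_irrefl _ hi
  have hy : ∀ i, b i < b j → glEquiv A⁻¹ (Pi.single l 1) i = 0 := by
    intro i hi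
    rw [glEquiv_single]
    exact hR i l (hjl ▸ hi)
  have h1 := hq _ hx
  have h2 := hq _ hy
  -- Polarize at `e_j` and `A⁻¹ e_l`: since `A` sends the second vector to `e_l`, the bilinear
  -- identity reduces to one entry of `A` and one entry of `A⁻¹`.
  have h3 := hq (Pi.single j 1 + glEquiv A⁻¹ (Pi.single l 1)) fun i hi => by
    rw [Pi.add_apply, hx i hi, hy i hi, add_zero]
  have h4 : ∑ i with b i = b j, sgn (ε i) * (A.val i j * (Pi.single l 1 : Fin n → ℝ) i) =
      ∑ i with b i = b j, sgn (ε i) * ((Pi.single j 1 : Fin n → ℝ) i * (A⁻¹).val i l) := by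
    simp only [map_add, Pi.add_apply, glEquiv_apply_inv, glEquiv_single] at h1 h2 h3
    have e : ∀ p q : Fin n → ℝ, ∑ i with b i = b j, sgn (ε i) * ((p i + q i) * (p i + q i)) =
        ∑ i with b i = b j, sgn (ε i) * (p i * p i) + ∑ i with b i = b j, sgn (ε i) * (q i * q i)
          + 2 * ∑ i with b i = b j, sgn (ε i) * (p i * q i) := by
      intro p q
      rw [Finset.mul_sum, ← Finset.sum_add_distrib, ← Finset.sum_add_distrib]
      refine Finset.sum_congr rfl fun i _ => ?_
      ring
    rw [e, e] at h3
    linarith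
  rw [Finset.sum_eq_single_of_mem l (by simp [hjl]) (fun i _ hi => by simp [hi]),
    Finset.sum_eq_single_of_mem j (by simp) (fun i _ hi => by simp [hi])] at h4
  simp only [Pi.single_eq_same, mul_one, one_mul] at h4
  linear_combination (-(A⁻¹).val j l) * sgn_mul_self (ε j) - sgn (ε j) * h4

/-- In an adapted basis the isometry group is the standard block group. -/
theorem isom_eq (ha : Adapted β g b ε) :
    β.isom = (blockGroup b ε).map (MulAut.conj g).toMonoidHom := by
  ext h
  rw [mem_map_conj_iff]
  exact ⟨ha.mem_of_mem_isom, ha.mem_isom_of_mem⟩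

end Adapted

/-- The contribution of a sign to the signature. -/
def sigUnit (u : ℤˣ) : ℕ × ℕ := if u = 1 then (0, 1) else (1, 0)

theorem sigUnit_neg (u : ℤˣ) : sigUnit (-u) = (sigUnit u).swap := by
  rcases Int.units_eq_one_or u with rfl | rfl <;> simp [sigUnit]

/-- The coordinates with index in `p` of a vector, in the basis of the columns of `g`. -/
noncomputable def coordMap (g : GL (Fin n) ℝ) (p : Fin n → Prop) (W : Submodule ℝ (Fin n → ℝ)) :
    W →ₗ[ℝ] ({j // p j} → ℝ) :=
  LinearMap.funLeft ℝ ℝ Subtype.val ∘ₗ (glEquiv g⁻¹).toLinearMap ∘ₗ W.subtype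

theorem coordMap_apply (g : GL (Fin n) ℝ) (p : Fin n → Prop) (W : Submodule ℝ (Fin n → ℝ))
    (x : W) (j : {j // p j}) : coordMap g p W x j = glEquiv g⁻¹ x j := rfl

/-- The coordinates on a piece of a flag given by the columns of `g`. -/
theorem exists_piece_equiv (F : PartialFlag n m) (g : GL (Fin n) ℝ) (b : Fin n → ℕ)
    (hV : ∀ (k : Fin (m + 1)) (x : Fin n → ℝ), x ∈ F.V k ↔ ∀ j, b j < k → glEquiv g⁻¹ x j = 0)
    (k : Fin m) :
    ∃ e : F.Piece k ≃ₗ[ℝ] ({j // b j = k} → ℝ), ∀ x j, e (F.toPiece k x) j = glEquiv g⁻¹ x j := by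
  set φ := coordMap g (fun j => b j = k) (F.V k.castSucc) with hφ
  have hker : (F.V k.succ).submoduleOf (F.V k.castSucc) = LinearMap.ker φ := by
    ext ⟨x, hx⟩
    rw [hV] at hx
    rw [LinearMap.mem_ker]
    change x ∈ F.V k.succ ↔ _
    rw [hV]
    constructor
    · intro h
      ext ⟨j, hj⟩
      exact h j (by simp [hj])
    · intro h j hj
      rcases (Nat.lt_succ_iff.1 hj).lt_or_eq with hj | hj
      · exact hx j hj
      · exact congrFun h ⟨j, hj⟩
  have hsurj : Function.Surjective φ := by
    intro y
    classical
    refine ⟨⟨glEquiv g fun j => if hj : b j = k then y ⟨j, hj⟩ else 0, ?_⟩, ?_⟩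
    · rw [hV]
      intro j hj
      rw [glEquiv_inv_apply, dif_neg]
      exact hj.ne
    · ext ⟨j, hj⟩
      rw [hφ, coordMap_apply, glEquiv_inv_apply, dif_pos hj]
  refine ⟨(Submodule.quotEquivOfEq _ _ hker).trans (φ.quotKerEquivOfSurjective hsurj), ?_⟩
  intro x j
  rfl

theorem toPiece_surjective (F : PartialFlag n m) (k : Fin m) :
    Function.Surjective (F.toPiece k) := Submodule.Quotient.mk_surjective _

theorem Adapted.equivalent {β : FlagForms F} {g : GL (Fin n) ℝ} {b : Fin n → ℕ}
    {ε : Fin n → ℤˣ} (ha : Adapted β g b ε) (k : Fin m) :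
    (β.form k).Equivalent
      (QuadraticMap.weightedSumSquares ℝ fun j : {j // b j = k} => sgn (ε j)) := by
  obtain ⟨e, he⟩ := exists_piece_equiv F g b ha.mem_iff' k
  refine ⟨⟨e, fun q => ?_⟩⟩
  obtain ⟨⟨x, hx⟩, rfl⟩ := toPiece_surjective F k q
  obtain ⟨v, rfl⟩ : ∃ v, x = glEquiv g v := ⟨_, (glEquiv_apply_inv g x).symm⟩
  rw [ha.form_eq k v hx]
  change QuadraticMap.weightedSumSquares ℝ _ (e _) = _
  rw [QuadraticMap.weightedSumSquares_apply, Finset.sum_subtype (p := fun j => b j = k) _ (by simp)]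
  refine Finset.sum_congr rfl fun j _ => ?_
  rw [he, glEquiv_inv_apply, smul_eq_mul]

/-- By Sylvester's law of inertia the signature counts the signs in the block. -/
theorem Adapted.signature_eq {β : FlagForms F} {g : GL (Fin n) ℝ} {b : Fin n → ℕ}
    {ε : Fin n → ℤˣ} (ha : Adapted β g b ε) (k : Fin m) :
    β.signature k = ∑ j with b j = k, sigUnit (ε j) := by
  have h1 : ∀ (p : ℝ → Prop) [DecidablePred p],
      {j : {j // b j = k} | p (sgn (ε j))}.ncard =
        ∑ j with b j = k, if p (sgn (ε j)) then 1 else 0 := by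
    intro p _
    rw [Finset.sum_subtype (p := fun j => b j = k) (F := inferInstance) _ (by simp),
      Set.ncard_eq_toFinset_card']
    simp
  unfold FlagForms.signature
  rw [QuadraticForm.sigNeg_of_equiv_weightedSumSquares (ha.equivalent k),
    QuadraticForm.sigPos_of_equiv_weightedSumSquares (ha.equivalent k),
    h1 (fun r => r < 0), h1 (fun r => 0 < r)]
  ext
  · rw [Prod.fst_sum]
    dsimp only
    refine Finset.sum_congr rfl fun j _ => ?_
    rcases Int.units_eq_one_or (ε j) with h | h <;> simp [sigUnit, h, sgn]
  · rw [Prod.snd_sum]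
    dsimp only
    refine Finset.sum_congr rfl fun j _ => ?_
    rcases Int.units_eq_one_or (ε j) with h | h <;> simp [sigUnit, h, sgn]

/-- The flag and the forms with a given adapted basis. -/
theorem exists_adapted_of_basis (K : GL (Fin n) ℝ) (b : Fin n → ℕ) (ε : Fin n → ℤˣ)
    (hlt : ∀ j, b j < m) (hsurj : ∀ k < m, ∃ j, b j = k) :
    ∃ (F : PartialFlag n m) (β : FlagForms F), Adapted β K b ε := by
  let W : ℕ → Submodule ℝ (Fin n → ℝ) := fun k =>
    { carrier := {x | ∀ j, b j < k → glEquiv K⁻¹ x j = 0}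
      zero_mem' := fun j _ => by simp
      add_mem' := fun hx hy j hj => by simp [hx j hj, hy j hj]
      smul_mem' := fun c x hx j hj => by simp [hx j hj] }
  have hW : ∀ k x, x ∈ W k ↔ ∀ j, b j < k → glEquiv K⁻¹ x j = 0 := fun _ _ => Iff.rfl
  let F : PartialFlag n m :=
    { V := fun k => W k
      V_zero := by
        rw [eq_top_iff]
        intro x _ j hj
        exact absurd hj (Nat.not_lt_zero _)
      V_last := by
        rw [eq_bot_iff]
        intro x hx
        have : glEquiv K⁻¹ x = 0 := funext fun j => hx j (hlt j)
        simpa using this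
      strictAnti := by
        intro k k' hkk
        refine lt_of_le_of_ne (fun x hx j hj => hx j (hj.trans hkk)) fun heq => ?_
        obtain ⟨j, hj⟩ := hsurj k (by omega)
        have h1 : glEquiv K (Pi.single j 1) ∈ W k := by
          rw [hW]
          intro i hi
          rw [glEquiv_inv_apply, Pi.single_apply, if_neg]
          rintro rfl
          omega
        replace heq : W k' = W k := heq
        rw [← heq, hW] at h1
        have h2 := h1 j (by omega)
        rw [glEquiv_inv_apply, Pi.single_eq_same] at h2
        exact one_ne_zero h2 }
  choose e he using exists_piece_equiv F K b fun k x => hW k x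
  let β : FlagForms F :=
    { form := fun k => (QuadraticMap.weightedSumSquares ℝ
        fun j : {j // b j = k} => sgn (ε j)).comp (e k).toLinearMap
      nondegenerate := fun k => by
        rw [QuadraticMap.nondegenerate_iff_radical_eq_bot, eq_bot_iff]
        intro q hq
        rw [QuadraticMap.mem_radical_iff'] at hq
        have h0 : e k q = 0 := by
          ext j
          classical
          -- Translating by the `j`-th basis vector does not change the value of the form at a
          -- radical vector, which kills its `j`-th coordinate.
          have h1 := hq.2 ((e k).symm (Pi.single j 1))
          have h2 := hq.1
          simp only [QuadraticMap.comp_apply, LinearEquiv.coe_coe, map_add,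
            LinearEquiv.apply_symm_apply, QuadraticMap.weightedSumSquares_apply, Pi.add_apply,
            smul_eq_mul] at h1 h2
          have h3 : ∑ i : {j // b j = k}, sgn (ε i) * ((e k q i + (Pi.single j 1 : _ → ℝ) i) *
              (e k q i + (Pi.single j 1 : _ → ℝ) i)) =
              ∑ i : {j // b j = k}, sgn (ε i) * (e k q i * e k q i) +
              ∑ i : {j // b j = k}, sgn (ε i) * ((Pi.single j 1 : _ → ℝ) i * (Pi.single j 1 : _ → ℝ) i) +
              2 * ∑ i : {j // b j = k}, sgn (ε i) * (e k q i * (Pi.single j 1 : _ → ℝ) i) := by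
            rw [Finset.mul_sum, ← Finset.sum_add_distrib, ← Finset.sum_add_distrib]
            refine Finset.sum_congr rfl fun i _ => ?_
            ring
          rw [h3, Finset.sum_eq_single (f := fun i : {j // b j = k} => sgn (ε i) *
            (e k q i * (Pi.single j 1 : _ → ℝ) i)) j (fun i _ hi => by simp [hi]) (by simp)] at h1
          have h4 : sgn (ε j) * e k q j = 0 := by
            simp only [Pi.single_eq_same, mul_one] at h1
            linarith
          exact (mul_eq_zero.1 h4).resolve_left (sgn_ne_zero _)
        simpa using h0 }
  refine ⟨F, β, hlt, fun k x => ?_, fun k x hx => ?_⟩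
  · change _ ∈ W k ↔ _
    rw [hW, glEquiv_inv_apply]
  · change QuadraticMap.weightedSumSquares ℝ _ (e k _) = _
    rw [QuadraticMap.weightedSumSquares_apply,
      Finset.sum_subtype (p := fun j => b j = k) _ (by simp)]
    refine Finset.sum_congr rfl fun j _ => ?_
    rw [he, glEquiv_inv_apply, smul_eq_mul]

end AdaptedBases

/-! ### The isometry group determines the flag, and the forms up to scalars -/

section Rigidity

variable {n m m' : ℕ} {F : PartialFlag n m}

/-- The reflection in a vector `v` with `∑ ε j * v j ^ 2 = q ≠ 0`. -/
noncomputable def reflGL (ε : Fin n → ℤˣ) (v : Fin n → ℝ) {q : ℝ} (hq0 : q ≠ 0)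
    (hq : ∑ j, sgn (ε j) * (v j * v j) = q) : GL (Fin n) ℝ :=
  have h : (1 - Matrix.of fun i j => 2 / q * (v i * (v j * sgn (ε j)))) *
      (1 - Matrix.of fun i j => 2 / q * (v i * (v j * sgn (ε j)))) =
      (1 : Matrix (Fin n) (Fin n) ℝ) := by
    have : (Matrix.of fun i j => 2 / q * (v i * (v j * sgn (ε j)))) *
        (Matrix.of fun i j => 2 / q * (v i * (v j * sgn (ε j)))) =
        (2 : ℝ) • (Matrix.of fun i j => 2 / q * (v i * (v j * sgn (ε j))) :
          Matrix (Fin n) (Fin n) ℝ) := by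
      ext i j
      rw [Matrix.mul_apply, Matrix.smul_apply]
      simp only [Matrix.of_apply]
      calc ∑ k, 2 / q * (v i * (v k * sgn (ε k))) * (2 / q * (v k * (v j * sgn (ε j))))
          = ∑ k, (2 / q * (2 / q) * (v i * (v j * sgn (ε j)))) * (sgn (ε k) * (v k * v k)) :=
            Finset.sum_congr rfl fun k _ => by ring
        _ = _ := by
            rw [← Finset.mul_sum, hq, smul_eq_mul]
            field_simp
    have key : ∀ M : Matrix (Fin n) (Fin n) ℝ, M * M = (2 : ℝ) • M → (1 - M) * (1 - M) = 1 := by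
      intro M hM
      rw [sub_mul, mul_sub, mul_sub, hM, two_smul]
      simp
    exact key _ this
  ⟨_, _, h, h⟩

theorem reflGL_apply (ε : Fin n → ℤˣ) (v : Fin n → ℝ) {q : ℝ} (hq0 : q ≠ 0)
    (hq : ∑ j, sgn (ε j) * (v j * v j) = q) (x : Fin n → ℝ) :
    glEquiv (reflGL ε v hq0 hq) x = x - (2 / q * ∑ j, sgn (ε j) * (v j * x j)) • v := by
  ext i
  change ∑ j, (1 - Matrix.of fun i j => 2 / q * (v i * (v j * sgn (ε j))) :
    Matrix (Fin n) (Fin n) ℝ) i j * x j = _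
  simp only [Matrix.sub_apply, sub_mul, Finset.sum_sub_distrib, Matrix.of_apply, Matrix.one_apply,
    Pi.sub_apply, Pi.smul_apply, smul_eq_mul]
  congr 1
  · simp
  · rw [Finset.mul_sum, Finset.sum_mul]
    exact Finset.sum_congr rfl fun j _ => by ring

theorem reflGL_mem (b : Fin n → ℕ) (ε : Fin n → ℤˣ) (v : Fin n → ℝ) {q : ℝ} (hq0 : q ≠ 0)
    (hq : ∑ j, sgn (ε j) * (v j * v j) = q) {k : ℕ} (hv : ∀ j, b j ≠ k → v j = 0) :
    reflGL ε v hq0 hq ∈ blockGroup b ε := by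
  have hL : BlockLower b (reflGL ε v hq0 hq).val := by
    intro i j hij
    change (1 : Matrix (Fin n) (Fin n) ℝ) i j - 2 / q * (v i * (v j * sgn (ε j))) = 0
    rw [BlockLower.one b i j hij]
    by_cases hi : b i = k
    · rw [hv j (by omega)]
      ring
    · rw [hv i hi]
      ring
  refine ⟨hL, hL, fun i j hij => ?_⟩
  change (1 : Matrix (Fin n) (Fin n) ℝ) i j - 2 / q * (v i * (v j * sgn (ε j))) =
    sgn (ε i) * sgn (ε j) *
      ((1 : Matrix (Fin n) (Fin n) ℝ) j i - 2 / q * (v j * (v i * sgn (ε i))))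
  rw [(BlockAdj.one (b := b) (ε := ε)).adj i j hij]
  linear_combination (2 / q * v i * v j * sgn (ε j)) * sgn_mul_self (ε i)

/-- The elementary matrix `1 + E i j`. -/
def elemGL (i j : Fin n) (hij : i ≠ j) : GL (Fin n) ℝ where
  val := Matrix.transvection i j 1
  inv := Matrix.transvection i j (-1)
  val_inv := by rw [Matrix.transvection_mul_transvection_same _ _ hij]; simp
  inv_val := by rw [Matrix.transvection_mul_transvection_same _ _ hij]; simp

theorem elemGL_mem (b : Fin n → ℕ) (ε : Fin n → ℤˣ) {i j : Fin n} (hij : b j < b i) :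
    elemGL i j (fun h => hij.ne (h ▸ rfl)) ∈ blockGroup b ε := by
  have h : ∀ (c : ℝ) (k l : Fin n), b k ≤ b l →
      Matrix.transvection i j c k l = (1 : Matrix (Fin n) (Fin n) ℝ) k l := by
    intro c k l hkl
    rw [Matrix.transvection, Matrix.add_apply, Matrix.single_apply, if_neg, add_zero]
    rintro ⟨rfl, rfl⟩
    omega
  refine ⟨fun k l hkl => ?_, fun k l hkl => ?_, fun k l hkl => ?_⟩
  · exact (h 1 k l hkl.le).trans (BlockLower.one b k l hkl)
  · exact (h (-1) k l hkl.le).trans (BlockLower.one b k l hkl)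
  · refine (h (-1) k l hkl.le).trans ?_
    rw [(BlockAdj.one (b := b) (ε := ε)).adj k l hkl, ← h 1 l k hkl.ge]
    rfl

theorem eq_sum_smul_single (x : Fin n → ℝ) :
    x = ∑ j, x j • (Pi.single j 1 : Fin n → ℝ) := by
  ext i
  simp [Finset.sum_apply, Pi.single_apply]

/-- A subspace of `ℝⁿ` invariant under the standard block group is a step of the standard flag. -/
theorem exists_eq_of_invariant_blockGroup {b : Fin n → ℕ} {ε : Fin n → ℤˣ}
    {W : Submodule ℝ (Fin n → ℝ)}
    (hW : ∀ A ∈ blockGroup b ε, ∀ x ∈ W, glEquiv A x ∈ W) {m : ℕ} (hm : ∀ j, b j < m) :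
    ∃ k, k ≤ m ∧ ∀ x, x ∈ W ↔ ∀ j, b j < k → x j = 0 := by
  have single_mem : ∀ x ∈ W, ∀ j, x j ≠ 0 → (Pi.single j 1 : Fin n → ℝ) ∈ W := by
    intro x hx j hj
    have hq : ∑ l, sgn (ε l) * ((Pi.single j 1 : Fin n → ℝ) l * (Pi.single j 1 : Fin n → ℝ) l) =
        sgn (ε j) := by
      rw [Finset.sum_eq_single j (fun l _ hl => by simp [hl]) (by simp)]
      simp
    -- The reflection in `e_j` moves `x` by `2 x_j e_j`, so `e_j` lies in `W` as soon as `x_j` is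
    -- nonzero.
    have h1 := hW _ (reflGL_mem b ε _ (sgn_ne_zero _) hq (k := b j) fun l hl => by
      rw [Pi.single_apply, if_neg]; rintro rfl; exact hl rfl) x hx
    rw [reflGL_apply, Finset.sum_eq_single j (fun l _ hl => by simp [hl]) (by simp)] at h1
    have h2 := W.sub_mem hx h1
    rw [sub_sub_cancel] at h2
    refine (W.smul_mem_iff ?_).1 h2
    have := sgn_ne_zero (ε j)
    simp only [Pi.single_eq_same]
    field_simp
    simpa using hj
  have step : ∀ i j, b j ≤ b i → (Pi.single j 1 : Fin n → ℝ) ∈ W →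
      (Pi.single i 1 : Fin n → ℝ) ∈ W := by
    intro i j hij hj
    rcases hij.lt_or_eq with hij | hij
    · refine single_mem _ (hW _ (elemGL_mem b ε hij) _ hj) i ?_
      rw [glEquiv_single]
      change Matrix.transvection i j 1 i j ≠ 0
      have : i ≠ j := by rintro rfl; exact lt_irrefl _ hij
      simp [Matrix.transvection, this]
    · by_cases hne : i = j
      · exact hne ▸ hj
      -- Within a block, reflect in `e_i + 2 e_j`. Its square `ε i + 4 ε j` is nonzero for all
      -- signs, whereas `e_i + e_j` is isotropic for opposite signs. The image of `e_j` has a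
      -- nonzero `i`-th coordinate.
      have hv : ∀ x : Fin n → ℝ, ∑ l, sgn (ε l) *
          ((Pi.single i 1 + Pi.single j 2 : Fin n → ℝ) l * x l) =
          sgn (ε i) * x i + 2 * (sgn (ε j) * x j) := by
        intro x
        simp only [Pi.add_apply, add_mul, mul_add, Finset.sum_add_distrib]
        rw [Finset.sum_eq_single i (fun l _ hl => by simp [hl]) (by simp),
          Finset.sum_eq_single j (fun l _ hl => by simp [hl]) (by simp)]
        simp
        ring
      have hq := hv (Pi.single i 1 + Pi.single j 2)
      have hq0 : sgn (ε i) * (Pi.single i 1 + Pi.single j 2 : Fin n → ℝ) i +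
          2 * (sgn (ε j) * (Pi.single i 1 + Pi.single j 2 : Fin n → ℝ) j) ≠ 0 := by
        simp only [Pi.add_apply, Pi.single_eq_same, Pi.single_eq_of_ne hne,
          Pi.single_eq_of_ne (Ne.symm hne)]
        rcases Int.units_eq_one_or (ε i) with h | h <;>
        rcases Int.units_eq_one_or (ε j) with h' | h' <;> simp [h, h', sgn] <;> norm_num
      refine single_mem _ (hW _ (reflGL_mem b ε _ hq0 hq (k := b j) fun l hl => ?_) _ hj) i ?_
      · rw [Pi.add_apply, Pi.single_eq_of_ne, Pi.single_eq_of_ne, add_zero]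
        · rintro rfl; exact hl rfl
        · rintro rfl; exact hl hij.symm
      · rw [reflGL_apply, hv]
        simp only [Pi.sub_apply, Pi.smul_apply, Pi.add_apply, Pi.single_eq_same,
          Pi.single_eq_of_ne hne, Pi.single_eq_of_ne (Ne.symm hne), smul_eq_mul, mul_zero,
          mul_one, add_zero, zero_add, zero_sub, neg_ne_zero] at hq0 ⊢
        exact mul_ne_zero (div_ne_zero two_ne_zero hq0) (mul_ne_zero two_ne_zero (sgn_ne_zero _))
  by_cases hJ : ∃ j, (Pi.single j 1 : Fin n → ℝ) ∈ W
  -- The step is the least block number of a basis vector in `W`; if `W` contains none, it is zero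
  -- and the last step `m` serves.
  · obtain ⟨j, hj, hmin⟩ := Set.exists_min_image {j | (Pi.single j 1 : Fin n → ℝ) ∈ W} b
      (Set.toFinite _) hJ
    refine ⟨b j, (hm j).le, fun x => ⟨fun hx i hi => ?_, fun hx => ?_⟩⟩
    · by_contra h
      exact absurd (hmin i (single_mem x hx i h)) (not_le.2 hi)
    · rw [eq_sum_smul_single x]
      refine W.sum_mem fun i _ => ?_
      rcases lt_or_ge (b i) (b j) with hi | hi
      · rw [hx i hi, zero_smul]
        exact W.zero_mem
      · exact W.smul_mem _ (step i j hi hj)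
  · refine ⟨m, le_rfl, fun x => ⟨fun hx i _ => ?_, fun hx => ?_⟩⟩
    · by_contra h
      exact hJ ⟨i, single_mem x hx i h⟩
    · rw [show x = 0 from funext fun j => hx j (hm j)]
      exact W.zero_mem

theorem Adapted.exists_eq_of_invariant {β : FlagForms F} {g : GL (Fin n) ℝ} {b : Fin n → ℕ}
    {ε : Fin n → ℤˣ} (ha : Adapted β g b ε) {W : Submodule ℝ (Fin n → ℝ)}
    (hW : ∀ h ∈ β.isom, W.map (glEquiv h).toLinearMap = W) : ∃ k, F.V k = W := by
  obtain ⟨k, hk, h⟩ := exists_eq_of_invariant_blockGroup (b := b) (ε := ε)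
    (W := W.comap (glEquiv g).toLinearMap) (fun A hA x hx => by
      have h1 : g * A * g⁻¹ ∈ β.isom := ha.mem_isom_of_mem (by simpa [mul_assoc] using hA)
      have h2 : glEquiv (g * A * g⁻¹) (glEquiv g x) ∈ W :=
        (hW _ h1).le (Submodule.mem_map_of_mem hx)
      rwa [← glEquiv_mul, inv_mul_cancel_right, glEquiv_mul] at h2) ha.lt
  refine ⟨⟨k, Nat.lt_succ_of_le hk⟩, ?_⟩
  ext x
  rw [ha.mem_iff']
  change (∀ j, b j < k → _) ↔ _
  rw [← h, Submodule.mem_comap]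
  change glEquiv g (glEquiv g⁻¹ x) ∈ W ↔ _
  rw [glEquiv_apply_inv]

/-- The isometry group determines the flag. -/
theorem flag_eq_of_isom_eq {F' : PartialFlag n m'} {β : FlagForms F} {β' : FlagForms F'}
    {g g' : GL (Fin n) ℝ} {b b' : Fin n → ℕ} {ε ε' : Fin n → ℤˣ} (ha : Adapted β g b ε)
    (ha' : Adapted β' g' b' ε') (h : β.isom = β'.isom) : ∃ hm : m = m', hm ▸ F = F' := by
  have h1 : ∀ k, ∃ k', F'.V k' = F.V k := fun k =>
    ha'.exists_eq_of_invariant fun A hA => by rw [← h] at hA; exact hA.1 k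
  have h2 : ∀ k, ∃ k', F.V k' = F'.V k := fun k =>
    ha.exists_eq_of_invariant fun A hA => by rw [h] at hA; exact hA.1 k
  -- The steps of each flag are invariant under the common group, hence steps of the other; a
  -- strictly descending chain is recovered from its set of members.
  have hr : Set.range F.V = Set.range F'.V := by
    apply Set.Subset.antisymm
    · rintro _ ⟨k, rfl⟩
      exact h1 k
    · rintro _ ⟨k, rfl⟩
      exact h2 k
  have hm : m = m' := by
    have h3 := congrArg Set.ncard hr
    rw [← Set.image_univ, ← Set.image_univ, Set.ncard_image_of_injective _ F.strictAnti.injective,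
      Set.ncard_image_of_injective _ F'.strictAnti.injective] at h3
    simpa [Set.ncard_univ] using h3
  subst hm
  refine ⟨rfl, ?_⟩
  have hV : F.V = F'.V := (F.strictAnti.range_inj F'.strictAnti).1 hr
  cases F
  cases F'
  cases hV
  rfl

theorem Adapted.exists_rep {β : FlagForms F} {g : GL (Fin n) ℝ} {b : Fin n → ℕ}
    {ε : Fin n → ℤˣ} (ha : Adapted β g b ε) (k : Fin m) (q : F.Piece k) :
    ∃ (z : Fin n → ℝ) (hz : glEquiv g z ∈ F.V k.castSucc),
      (∀ j, b j ≠ k → z j = 0) ∧ F.toPiece k ⟨_, hz⟩ = q := by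
  classical
  obtain ⟨e, he⟩ := exists_piece_equiv F g b ha.mem_iff' k
  have hz : glEquiv g (fun j => if hj : b j = k then e q ⟨j, hj⟩ else 0) ∈ F.V k.castSucc := by
    rw [ha.mem_iff]
    intro j hj
    rw [dif_neg]
    exact hj.ne
  refine ⟨_, hz, fun j hj => dif_neg hj, e.injective ?_⟩
  ext ⟨j, hj⟩
  rw [he, glEquiv_inv_apply, dif_pos hj]

theorem Adapted.polar_eq {β : FlagForms F} {g : GL (Fin n) ℝ} {b : Fin n → ℕ}
    {ε : Fin n → ℤˣ} (ha : Adapted β g b ε) (k : Fin m) {x y : Fin n → ℝ}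
    (hx : glEquiv g x ∈ F.V k.castSucc) (hy : glEquiv g y ∈ F.V k.castSucc) :
    QuadraticMap.polar (β.form k) (F.toPiece k ⟨_, hx⟩) (F.toPiece k ⟨_, hy⟩) =
      2 * ∑ j with b j = k, sgn (ε j) * (x j * y j) := by
  have hxy : glEquiv g (x + y) ∈ F.V k.castSucc := by
    rw [map_add]
    exact add_mem hx hy
  have e : F.toPiece k ⟨_, hx⟩ + F.toPiece k ⟨_, hy⟩ = F.toPiece k ⟨_, hxy⟩ := by
    unfold PartialFlag.toPiece
    rw [← Submodule.Quotient.mk_add]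
    congr 1
    ext1
    simp
  rw [QuadraticMap.polar, e, ha.form_eq, ha.form_eq, ha.form_eq, Finset.mul_sum,
    ← Finset.sum_sub_distrib, ← Finset.sum_sub_distrib]
  refine Finset.sum_congr rfl fun j _ => ?_
  rw [Pi.add_apply]
  ring

theorem sum_filter_eq_sum {b : Fin n → ℕ} {k : ℕ} (f : Fin n → ℝ) (hf : ∀ j, b j ≠ k → f j = 0) :
    ∑ j with b j = k, f j = ∑ j, f j := by
  rw [Finset.sum_filter]
  refine Finset.sum_congr rfl fun j _ => ?_
  split_ifs with hj
  · rfl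
  · exact (hf j hj).symm

/-- Vectors orthogonal for a form of `β` are orthogonal for the form of `β'` if `β` and `β'` have
the same isometries. -/
theorem polar_eq_zero_of_isom_eq {β β' : FlagForms F} {g : GL (Fin n) ℝ} {b : Fin n → ℕ}
    {ε : Fin n → ℤˣ} (ha : Adapted β g b ε) (h : β.isom = β'.isom) (k : Fin m) {x v : F.Piece k}
    (hv : β.form k v ≠ 0) (hxv : QuadraticMap.polar (β.form k) x v = 0) :
    QuadraticMap.polar (β'.form k) x v = 0 := by
  obtain ⟨z, hz, hz0, rfl⟩ := ha.exists_rep k x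
  obtain ⟨y, hy, hy0, rfl⟩ := ha.exists_rep k v
  rw [ha.form_eq, sum_filter_eq_sum _ fun j hj => by rw [hy0 j hj]; ring] at hv
  rw [ha.polar_eq, sum_filter_eq_sum _ fun j hj => by rw [hy0 j hj]; ring] at hxv
  have hzy : ∑ j, sgn (ε j) * (y j * z j) = 0 := by
    simpa [mul_comm (y _)] using hxv
  -- This reflection fixes `z` and negates `y`, so it exchanges `z + y` and `z - y`. As it also
  -- preserves `β'`, the form of `β'` takes equal values there and its polar form vanishes on the
  -- pair.
  set R := reflGL ε y hv rfl with hR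
  have hRz : glEquiv R z = z := by rw [hR, reflGL_apply, hzy]; simp
  have hRy : glEquiv R y = -y := by
    rw [hR, reflGL_apply, div_mul_cancel₀ _ hv, two_smul]
    abel
  have hmem : g * R * g⁻¹ ∈ β'.isom := by
    rw [← h]
    refine ha.mem_isom_of_mem ?_
    have : g⁻¹ * (g * R * g⁻¹) * g = R := by group
    rw [this]
    exact reflGL_mem b ε y hv rfl hy0
  have h1 : ∀ u, glEquiv (g * R * g⁻¹) (glEquiv g u) = glEquiv g (glEquiv R u) := by
    intro u
    rw [← glEquiv_mul, inv_mul_cancel_right, glEquiv_mul]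
  have h2 := hmem.2 k (⟨_, hz⟩ + ⟨_, hy⟩) (⟨_, hz⟩ - ⟨_, hy⟩) (by
    simp only [Submodule.coe_add, Submodule.coe_sub, map_add, h1, hRz, hRy, map_neg]
    abel)
  have h3 : β'.form k (F.toPiece k ⟨_, hz⟩ - F.toPiece k ⟨_, hy⟩) =
      β'.form k (F.toPiece k ⟨_, hz⟩ + F.toPiece k ⟨_, hy⟩) := h2
  have h4 := QuadraticMap.polar_neg_right (β'.form k) (F.toPiece k ⟨_, hz⟩) (F.toPiece k ⟨_, hy⟩)
  simp only [QuadraticMap.polar, ← sub_eq_add_neg, QuadraticMap.map_neg, h3] at h4 ⊢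
  linarith

/-- A quadratic form with more orthogonal pairs than a weighted sum of squares is a multiple of
it. -/
theorem exists_smul_eq_weightedSumSquares {J : Type*} [Fintype J] {w : J → ℝ} (hw : ∀ j, w j ≠ 0)
    (hw2 : ∀ i j, w i + 4 * w j ≠ 0) (Q : QuadraticForm ℝ (J → ℝ))
    (hQ : ∀ x v, QuadraticMap.weightedSumSquares ℝ w v ≠ 0 →
      QuadraticMap.polar (QuadraticMap.weightedSumSquares ℝ w) x v = 0 →
        QuadraticMap.polar Q x v = 0) :
    ∃ c : ℝ, ∀ x, Q x = c * QuadraticMap.weightedSumSquares ℝ w x := by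
  classical
  set Q₀ := QuadraticMap.weightedSumSquares ℝ w with hQ₀
  have pol : ∀ x y, QuadraticMap.polar Q₀ x y = 2 * ∑ j, w j * (x j * y j) := by
    intro x y
    simp only [QuadraticMap.polar, hQ₀, QuadraticMap.weightedSumSquares_apply, smul_eq_mul,
      Pi.add_apply]
    rw [Finset.mul_sum, ← Finset.sum_sub_distrib, ← Finset.sum_sub_distrib]
    exact Finset.sum_congr rfl fun j _ => by ring
  have key : ∀ x v, Q₀ v ≠ 0 →
      QuadraticMap.polar Q x v = Q v / Q₀ v * QuadraticMap.polar Q₀ x v := by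
    intro x v hv
    -- Subtracting the `Q₀`-projection of `x` on `v` gives a vector orthogonal to `v` for `Q₀`,
    -- hence for `Q`.
    have h1 := hQ (x - (QuadraticMap.polar Q₀ x v / (2 * Q₀ v)) • v) v hv (by
      rw [QuadraticMap.polar_sub_left, QuadraticMap.polar_smul_left, QuadraticMap.polar_self]
      simp only [smul_eq_mul, nsmul_eq_mul, Nat.cast_ofNat]
      field_simp
      ring)
    rw [QuadraticMap.polar_sub_left, QuadraticMap.polar_smul_left, QuadraticMap.polar_self] at h1
    simp only [smul_eq_mul, nsmul_eq_mul, Nat.cast_ofNat] at h1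
    rw [sub_eq_zero.1 h1]
    field_simp
  have hs : ∀ j, Q₀ (Pi.single j 1) = w j := by
    intro j
    rw [hQ₀, QuadraticMap.weightedSumSquares_apply,
      Finset.sum_eq_single j (fun l _ hl => by simp [hl]) (by simp)]
    simp
  have ps : ∀ x j, QuadraticMap.polar Q₀ x (Pi.single j 1) = 2 * (w j * x j) := by
    intro x j
    rw [pol, Finset.sum_eq_single j (fun l _ hl => by simp [hl]) (by simp)]
    simp
  have ratio : ∀ i j, Q (Pi.single i 1) / w i = Q (Pi.single j 1) / w j := by
    intro i j
    by_cases hij : i = j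
    · rw [hij]
    -- The vector `v` is non-isotropic by `hw2` and orthogonal to neither basis vector, so symmetry
    -- of the polar forms makes both ratios equal to `Q v / Q₀ v`.
    set v : J → ℝ := Pi.single i 1 + (2 : ℝ) • Pi.single j 1 with hv
    have hvi : v i = 1 := by simp [hv, hij]
    have hvj : v j = 2 := by simp [hv, Ne.symm hij]
    have hQv : Q₀ v = w i + 4 * w j := by
      rw [hv, QuadraticMap.map_add Q₀, QuadraticMap.polar_smul_right, ps, QuadraticMap.map_smul, hs,
        hs, Pi.single_eq_of_ne (Ne.symm hij)]
      simp only [smul_eq_mul]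
      ring
    have aux : ∀ l, v l ≠ 0 → Q (Pi.single l 1) / w l = Q v / Q₀ v := by
      intro l hl
      have h1 := key v (Pi.single l 1) (by rw [hs]; exact hw l)
      have h2 := key (Pi.single l 1) v (by rw [hQv]; exact hw2 i j)
      rw [QuadraticMap.polar_comm Q, h1, QuadraticMap.polar_comm Q₀, hs] at h2
      refine mul_right_cancel₀ ?_ h2
      rw [QuadraticMap.polar_comm, ps]
      exact mul_ne_zero two_ne_zero (mul_ne_zero (hw l) hl)
    rw [aux i (by rw [hvi]; norm_num), aux j (by rw [hvj]; norm_num)]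
  rcases isEmpty_or_nonempty J with hJ | ⟨⟨j₀⟩⟩
  · refine ⟨0, fun x => ?_⟩
    rw [Subsingleton.elim x 0, QuadraticMap.map_zero, zero_mul]
  · refine ⟨Q (Pi.single j₀ 1) / w j₀, fun x => ?_⟩
    have hlin : QuadraticMap.polarBilin Q x =
        (Q (Pi.single j₀ 1) / w j₀) • QuadraticMap.polarBilin Q₀ x := by
      refine (Pi.basisFun ℝ J).ext fun j => ?_
      rw [Pi.basisFun_apply, LinearMap.smul_apply, QuadraticMap.polarBilin_apply_apply,
        QuadraticMap.polarBilin_apply_apply, key x _ (by rw [hs]; exact hw j), hs, ratio j j₀,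
        smul_eq_mul]
    have h1 := LinearMap.congr_fun hlin x
    rw [LinearMap.smul_apply, QuadraticMap.polarBilin_apply_apply,
      QuadraticMap.polarBilin_apply_apply, QuadraticMap.polar_self, QuadraticMap.polar_self] at h1
    simp only [smul_eq_mul, nsmul_eq_mul, Nat.cast_ofNat] at h1
    linarith

/-- Scaling vectors by `√c` is an isometry between the two forms. -/
theorem sigPos_of_pos_smul {E : Type*} [AddCommGroup E] [Module ℝ E] {Q Q' : QuadraticForm ℝ E}
    {c : ℝ} (hc : 0 < c) (h : ∀ x, Q' x = c * Q x) : sigPos Q' = sigPos Q ∧ sigNeg Q' = sigNeg Q := by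
  have hs : √c ≠ 0 := (Real.sqrt_pos.2 hc).ne'
  have e : Q'.Equivalent Q := by
    refine ⟨⟨LinearEquiv.smulOfNeZero ℝ E (√c) hs, fun x => ?_⟩⟩
    change Q (√c • x) = Q' x
    rw [QuadraticMap.map_smul, Real.mul_self_sqrt hc.le, h, smul_eq_mul]
  exact ⟨e.sigPos_eq, e.sigNeg_eq⟩

/-- The isometry group determines the signature of each form up to sign. -/
theorem signature_eq_or_swap_of_isom_eq {β β' : FlagForms F} {g : GL (Fin n) ℝ} {b : Fin n → ℕ}
    {ε : Fin n → ℤˣ} (ha : Adapted β g b ε) (h : β.isom = β'.isom) (k : Fin m) :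
    β'.signature k = β.signature k ∨ β'.signature k = (β.signature k).swap := by
  obtain ⟨c, hc⟩ : ∃ c : ℝ, ∀ x, β'.form k x = c * β.form k x := by
    obtain ⟨e⟩ := ha.equivalent k
    have he : ∀ y, β.form k (e.symm y) = QuadraticMap.weightedSumSquares ℝ _ y :=
      fun y => e.symm.map_app y
    have hpol : ∀ (Q : QuadraticForm ℝ (F.Piece k)) x y,
        QuadraticMap.polar (Q.comp e.toLinearEquiv.symm.toLinearMap) x y =
        QuadraticMap.polar Q (e.symm x) (e.symm y) := by
      intro Q x y
      simp only [QuadraticMap.polar, QuadraticMap.comp_apply, map_add]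
      rfl
    obtain ⟨c, hc⟩ := exists_smul_eq_weightedSumSquares
      (w := fun j : {j // b j = k} => sgn (ε j)) (fun j => sgn_ne_zero _) (fun i j => by
        rcases Int.units_eq_one_or (ε i) with h | h <;>
        rcases Int.units_eq_one_or (ε j) with h' | h' <;> simp [h, h', sgn] <;> norm_num)
      ((β'.form k).comp e.toLinearEquiv.symm.toLinearMap) (fun x v hv hxv => by
        rw [hpol]
        refine polar_eq_zero_of_isom_eq ha h k (by rwa [he]) ?_
        rw [← hpol, ← hxv]
        congr 1
        ext y
        exact he y)
    refine ⟨c, fun x => ?_⟩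
    have h1 := hc (e x)
    rw [e.map_app] at h1
    rw [← h1, QuadraticMap.comp_apply]
    congr 1
    exact (e.toLinearEquiv.symm_apply_apply x).symm
  unfold FlagForms.signature
  rcases lt_trichotomy c 0 with h0 | h0 | h0
  · right
    -- For negative `c` the form `-β'.form k` is a positive multiple of `β.form k`, which exchanges
    -- the two indices.
    obtain ⟨h1, h2⟩ := sigPos_of_pos_smul (Q := β.form k) (Q' := -β'.form k) (c := -c)
      (by linarith) fun x => by rw [neg_apply, hc]; ring
    rw [sigPos_neg] at h1
    rw [sigNeg_neg] at h2
    rw [h1, h2, Prod.swap_prod_mk]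
  · exfalso
    -- If `c = 0`, the form of `β'` would vanish on a nonzero piece, against nondegeneracy.
    obtain ⟨j, hj⟩ := ha.surj k
    have hx : glEquiv g (Pi.single j 1) ∈ F.V k.castSucc := ha.single_mem hj.ge
    have h1 := (β'.nondegenerate k).radical_eq_bot
    have h2 : F.toPiece k ⟨_, hx⟩ ∈ (β'.form k).radical := by
      rw [QuadraticMap.mem_radical_iff']
      exact ⟨by rw [hc, h0, zero_mul], fun y => by rw [hc, hc, h0, zero_mul, zero_mul]⟩
    rw [h1, Submodule.mem_bot] at h2
    have h3 := ha.form_eq k _ hx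
    rw [h2, QuadraticMap.map_zero, Finset.sum_eq_single j (fun l _ hl => by simp [hl])
      (by simp [hj])] at h3
    simp only [Pi.single_eq_same, mul_one] at h3
    exact sgn_ne_zero _ h3.symm
  · left
    obtain ⟨h1, h2⟩ := sigPos_of_pos_smul h0 hc
    rw [h1, h2]

end Rigidity

/-! ### Adapted bases orthogonal after an arbitrary linear map -/

section OrthonormalAdapted

/-- The spectral theorem for the symmetric operator `T` that represents the polar form: orthogonal
eigenvectors are also orthogonal for `Q`. -/
theorem exists_orthonormalBasis_polar_eq_zero {E : Type*} [NormedAddCommGroup E]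
    [InnerProductSpace ℝ E] [FiniteDimensional ℝ E] (Q : QuadraticForm ℝ E) :
    ∃ v : OrthonormalBasis (Fin (Module.finrank ℝ E)) ℝ E,
      ∀ i j, i ≠ j → QuadraticMap.polar Q (v i) (v j) = 0 := by
  set e := stdOrthonormalBasis ℝ E
  let T : E →ₗ[ℝ] E := ∑ i, (Q.polarBilin.flip (e i)).smulRight (e i)
  have hT : ∀ x y, inner ℝ (T x) y = QuadraticMap.polar Q x y := by
    intro x y
    have h1 : T x = ∑ i, QuadraticMap.polar Q x (e i) • e i := by
      simp [T, LinearMap.sum_apply]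
    have h2 : QuadraticMap.polar Q x y = Q.polarBilin x (∑ i, inner ℝ (e i) y • e i) := by
      rw [e.sum_repr']
      rfl
    rw [h1, h2, sum_inner, map_sum]
    refine Finset.sum_congr rfl fun i _ => ?_
    rw [real_inner_smul_left, map_smul, smul_eq_mul, mul_comm]
    rfl
  have hsymm : T.IsSymmetric := by
    intro x y
    rw [hT, real_inner_comm, hT, QuadraticMap.polar_comm]
  refine ⟨hsymm.eigenvectorBasis rfl, fun i j hij => ?_⟩
  rw [← hT, hsymm.apply_eigenvectorBasis, real_inner_smul_left,
    (hsymm.eigenvectorBasis rfl).orthonormal.2 hij, mul_zero]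

/-- The space is the orthogonal sum of the complements of `W k.succ` in `W k.castSucc`. Each
complement models a quotient, so the form can be diagonalized in it orthonormally. -/
theorem exists_orthonormalBasis_flag {E : Type*} [NormedAddCommGroup E]
    [InnerProductSpace ℝ E] [FiniteDimensional ℝ E] {n m : ℕ} (hn : Module.finrank ℝ E = n)
    (W : Fin (m + 1) → Submodule ℝ E) (hW : Antitone W) (h0 : W 0 = ⊤) (hm : W (Fin.last m) = ⊥)
    (Q : ∀ k : Fin m, QuadraticForm ℝ (W k.castSucc)) :
    ∃ (v : OrthonormalBasis (Fin n) ℝ E) (b : Fin n → Fin m)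
      (hv : ∀ j, v j ∈ W (b j).castSucc),
      (∀ j, v j ∈ (W (b j).succ)ᗮ) ∧
      ∀ k i j (hi : b i = k) (hj : b j = k), i ≠ j →
        QuadraticMap.polar (Q k) ⟨v i, hi ▸ hv i⟩ ⟨v j, hj ▸ hv j⟩ = 0 := by
  set U : Fin m → Submodule ℝ E := fun k => (W k.succ)ᗮ ⊓ W k.castSucc with hU
  have hfam : OrthogonalFamily ℝ (fun k => U k) fun k => (U k).subtypeₗᵢ := by
    refine OrthogonalFamily.of_pairwise fun k k' hkk => ?_
    wlog h : k < k' generalizing k k'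
    · exact (this k' k (Ne.symm hkk) ((lt_or_gt_of_ne hkk).resolve_left h)).symm
    · refine Submodule.isOrtho_iff_le.2 fun x hx => ?_
      exact Submodule.orthogonal_le ((inf_le_right : U k' ≤ _).trans
        (hW (Fin.succ_le_castSucc_iff.2 h))) hx.1
  have hsup : ∀ k, W k ≤ iSup U := by
    intro k
    induction k using Fin.reverseInduction with
    | last => rw [hm]; exact bot_le
    | cast k ih =>
      rw [← Submodule.sup_orthogonal_inf_of_hasOrthogonalProjection
        (hW (Fin.castSucc_lt_succ (i := k)).le)]
      exact sup_le ih (le_iSup U k)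
  have hint : DirectSum.IsInternal U := by
    rw [hfam.isInternal_iff, show iSup U = ⊤ from eq_top_iff.2 (h0 ▸ hsup 0),
      Submodule.top_orthogonal_eq_bot]
  choose vf hvf using fun k => exists_orthonormalBasis_polar_eq_zero
    ((Q k).comp (Submodule.inclusion (inf_le_right : U k ≤ _)))
  set B := hint.collectedOrthonormalBasis hfam vf with hB
  have hBa : ∀ a, B a = vf a.1 a.2 := by
    intro a
    simp [hB, DirectSum.IsInternal.collectedOrthonormalBasis]
  have hcard : Fintype.card (Σ k, Fin (Module.finrank ℝ (U k))) = n := by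
    rw [← hn, Module.finrank_eq_card_basis B.toBasis]
  set σ := Fintype.equivFinOfCardEq hcard
  have hmem : ∀ j, B.reindex σ j ∈ U (σ.symm j).1 := by
    intro j
    rw [OrthonormalBasis.reindex_apply, hBa]
    exact (vf _ _).2
  refine ⟨B.reindex σ, fun j => (σ.symm j).1, fun j => (hmem j).2, fun j => (hmem j).1, ?_⟩
  intro k i j hi hj hij
  obtain ⟨⟨k₁, a₁⟩, rfl⟩ := σ.surjective i
  obtain ⟨⟨k₂, a₂⟩, rfl⟩ := σ.surjective j
  simp only [Equiv.symm_apply_apply] at hi hj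
  subst hi
  subst hj
  have h := hvf k₂ a₁ a₂ (by rintro rfl; exact hij rfl)
  rw [← h]
  have e : ∀ a, (⟨B.reindex σ (σ ⟨k₂, a⟩), by
      have := (hmem (σ ⟨k₂, a⟩)).2; simpa using this⟩ : W k₂.castSucc) =
      Submodule.inclusion (inf_le_right : U k₂ ≤ _) (vf k₂ a) := by
    intro a
    ext1
    simp [OrthonormalBasis.reindex_apply, hBa]
  rw [e, e]
  simp only [QuadraticMap.polar, QuadraticMap.comp_apply, map_add]

variable {n m : ℕ} {F : PartialFlag n m}

/-- A basis that diagonalizes all forms of `β` can be rescaled to an adapted basis. -/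
theorem exists_adapted_rescale (β : FlagForms F) (g : GL (Fin n) ℝ) (b : Fin n → Fin m)
    (hmem : ∀ (k : Fin (m + 1)) (x : Fin n → ℝ),
      glEquiv g x ∈ F.V k ↔ ∀ j, (b j : ℕ) < k → x j = 0)
    (hpol : ∀ k i j (hi : glEquiv g (Pi.single i 1) ∈ F.V k.castSucc)
      (hj : glEquiv g (Pi.single j 1) ∈ F.V k.castSucc), b i = k → b j = k → i ≠ j →
      QuadraticMap.polar (β.form k) (F.toPiece k ⟨_, hi⟩) (F.toPiece k ⟨_, hj⟩) = 0) :
    ∃ (ε : Fin n → ℤˣ) (t : Fin n → ℝˣ), Adapted β (g * diagGL t) (fun j => b j) ε := by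
  have hs : ∀ j, glEquiv g (Pi.single j 1) ∈ F.V (b j).castSucc := by
    intro j
    rw [hmem]
    intro i hi
    rw [Pi.single_apply, if_neg]
    rintro rfl
    exact lt_irrefl _ hi
  set w : Fin n → ℝ := fun j => β.form (b j) (F.toPiece (b j) ⟨_, hs j⟩) with hw
  have hform : ∀ (k : Fin m) (x : Fin n → ℝ) (hx : glEquiv g x ∈ F.V k.castSucc),
      β.form k (F.toPiece k ⟨_, hx⟩) = ∑ j with (b j : ℕ) = k, w j * (x j * x j) ∧
      ∀ j, b j = k → w j ≠ 0 := by
    intro k x hx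
    obtain ⟨e, he⟩ := exists_piece_equiv F g (fun j => (b j : ℕ))
      (fun k x => by rw [← hmem, glEquiv_apply_inv]) k
    let v := Module.Basis.ofEquivFun e
    have hv : ∀ (j : {j // (b j : ℕ) = k}) (hj : glEquiv g (Pi.single j.1 1) ∈ F.V k.castSucc),
        v j = F.toPiece k ⟨_, hj⟩ := by
      intro j hj
      apply e.injective
      ext i
      rw [he, glEquiv_inv_apply, Module.Basis.coe_ofEquivFun, LinearEquiv.apply_symm_apply]
      simp [Pi.single_apply, Subtype.ext_iff]
    have hvs : ∀ j : {j // (b j : ℕ) = k}, glEquiv g (Pi.single j.1 1) ∈ F.V k.castSucc := by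
      rintro ⟨j, hj⟩
      have := hs j
      rwa [show b j = k from Fin.ext hj] at this
    have hvw : ∀ j, β.form k (v j) = w j := by
      rintro ⟨j, hj⟩
      obtain rfl : b j = k := Fin.ext hj
      rw [hv _ (hs j)]
    have hortho : (QuadraticMap.associated (R := ℝ) (β.form k)).IsOrthoᵢ v := by
      rw [LinearMap.isOrthoᵢ_def]
      intro i j hij
      have := hpol k i j (hvs i) (hvs j) (Fin.ext i.2) (Fin.ext j.2) fun h => hij (Subtype.ext h)
      rw [QuadraticMap.associated_apply, hv i (hvs i), hv j (hvs j)]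
      rw [QuadraticMap.polar] at this
      rw [this, smul_zero]
    have hrepr := QuadraticMap.basisRepr_eq_of_iIsOrtho (β.form k) v hortho
    have hval : ∀ q, β.form k q = ∑ j : {j // (b j : ℕ) = k}, w j * (e q j * e q j) := by
      intro q
      have h1 := congrArg (fun Q => Q (e q)) hrepr
      simp only [QuadraticMap.basisRepr_apply, QuadraticMap.weightedSumSquares_apply, hvw,
        smul_eq_mul] at h1
      rw [← h1]
      congr 1
      exact (v.sum_equivFun q).symm
    constructor
    · rw [hval, Finset.sum_subtype (p := fun j => (b j : ℕ) = k) (F := inferInstance) _ (by simp)]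
      refine Finset.sum_congr rfl fun j _ => ?_
      rw [he, glEquiv_inv_apply]
    · intro j hj hwj
      have h1 : v ⟨j, congrArg _ hj⟩ ∈ (β.form k).radical := by
        rw [QuadraticMap.mem_radical_iff']
        refine ⟨by rw [hvw, hwj], fun q => ?_⟩
        rw [hval, hval]
        refine Finset.sum_congr rfl fun i _ => ?_
        rw [map_add, Pi.add_apply, Module.Basis.coe_ofEquivFun, LinearEquiv.apply_symm_apply]
        by_cases hij : i = ⟨j, congrArg _ hj⟩
        · rw [hij]
          simp [hwj]
        · rw [Pi.single_eq_of_ne hij, zero_add]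
      rw [(β.nondegenerate k).radical_eq_bot, Submodule.mem_bot] at h1
      exact v.ne_zero _ h1
  have hw0 : ∀ j, w j ≠ 0 := fun j => (hform (b j) _ (hs j)).2 j rfl
  -- Dividing the `j`-th vector by `√|w j|` turns its square `w j` into its sign.
  have hsq : ∀ j, √|w j| ≠ 0 := fun j => (Real.sqrt_pos.2 (abs_pos.2 (hw0 j))).ne'
  refine ⟨fun j => if 0 < w j then 1 else -1, fun j => (Units.mk0 _ (hsq j))⁻¹,
    fun j => (b j).2, fun k x => ?_, fun k x hx => ?_⟩
  · rw [glEquiv_mul, hmem]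
    refine forall₂_congr fun j _ => ?_
    rw [glEquiv_apply, diagGL_val, Matrix.mulVec_diagonal]
    simp [(hsq j)]
  · simp only [glEquiv_mul] at hx ⊢
    rw [(hform k _ hx).1]
    refine Finset.sum_congr rfl fun j _ => ?_
    rw [glEquiv_apply, diagGL_val, Matrix.mulVec_diagonal]
    have h1 : √|w j| * √|w j| = |w j| := Real.mul_self_sqrt (abs_nonneg _)
    have h2 : w j = sgn (if 0 < w j then 1 else -1) * |w j| := by
      split_ifs with h
      · simp [sgn, abs_of_pos h]
      · simp [sgn, abs_of_nonpos (not_lt.1 h)]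
    have h3 := hsq j
    simp only [Units.val_inv_eq_inv_val, Units.val_mk0]
    rw [← h1] at h2
    generalize (if 0 < w j then (1 : ℤˣ) else -1) = s at h2 ⊢
    generalize √|w j| = r at h2 h3 ⊢
    rw [h2]
    field_simp

/-- For every `c` there is an adapted basis whose image under `c` is orthogonal for the standard
inner product. -/
theorem exists_adapted_orthogonal (β : FlagForms F) (c : GL (Fin n) ℝ) :
    ∃ (g : GL (Fin n) ℝ) (b : Fin n → ℕ) (ε : Fin n → ℤˣ) (o : GL (Fin n) ℝ) (t : Fin n → ℝˣ),
      Adapted β g b ε ∧ c * g = o * diagGL t ∧ (o⁻¹).val = o.val.transpose := by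
  -- The flag and forms are transported by `c` to Euclidean space. An orthonormal basis found there
  -- supplies the columns of `o`, and pulling it back by `c⁻¹` diagonalizes `β`.
  let τ : (Fin n → ℝ) ≃ₗ[ℝ] EuclideanSpace ℝ (Fin n) :=
    (glEquiv c).trans (WithLp.linearEquiv 2 ℝ (Fin n → ℝ)).symm
  let W : Fin (m + 1) → Submodule ℝ (EuclideanSpace ℝ (Fin n)) :=
    fun k => (F.V k).map τ.toLinearMap
  have hWmem : ∀ k x, x ∈ W k ↔ τ.symm x ∈ F.V k := fun k x => Submodule.mem_map_equiv (F.V k)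
  let ψ : ∀ k : Fin m, W k.castSucc →ₗ[ℝ] F.Piece k := fun k =>
    Submodule.mkQ _ ∘ₗ (τ.symm.toLinearMap ∘ₗ (W k.castSucc).subtype).codRestrict (F.V k.castSucc)
      fun x => (hWmem _ _).1 x.2
  have hWanti : Antitone W := fun k k' hkk => Submodule.map_mono (F.strictAnti.antitone hkk)
  obtain ⟨v, b, hv, hv', hpol⟩ := exists_orthonormalBasis_flag (n := n) (by simp) W
    hWanti (by simp [W, F.V_zero])
    (by simp [W, F.V_last]) fun k => (β.form k).comp (ψ k)
  let o : GL (Fin n) ℝ :=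
    have h : (Matrix.of fun i j => v j i).transpose * (Matrix.of fun i j => v j i) =
        (1 : Matrix (Fin n) (Fin n) ℝ) := by
      ext i j
      have h1 := orthonormal_iff_ite.1 v.orthonormal i j
      rw [PiLp.inner_apply] at h1
      rw [Matrix.mul_apply, Matrix.one_apply, ← h1]
      refine Finset.sum_congr rfl fun l _ => ?_
      simp [mul_comm]
    ⟨Matrix.of fun i j => v j i, (Matrix.of fun i j => v j i).transpose,
      mul_eq_one_comm.1 h, h⟩
  have hτo : ∀ x, τ (glEquiv (c⁻¹ * o) x) = ∑ j, x j • v j := by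
    intro x
    have h1 : τ (glEquiv (c⁻¹ * o) x) = WithLp.toLp 2 (glEquiv o x) := by
      change WithLp.toLp 2 (glEquiv c (glEquiv (c⁻¹ * o) x)) = _
      rw [← glEquiv_mul, mul_inv_cancel_left]
    rw [h1]
    ext i
    change ∑ j, v j i * x j = _
    simp [mul_comm]
  have hmem : ∀ (k : Fin (m + 1)) (x : Fin n → ℝ),
      glEquiv (c⁻¹ * o) x ∈ F.V k ↔ ∀ j, (b j : ℕ) < k → x j = 0 := by
    intro k x
    have h1 : glEquiv (c⁻¹ * o) x ∈ F.V k ↔ ∑ j, x j • v j ∈ W k := by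
      rw [← hτo, hWmem, LinearEquiv.symm_apply_apply]
    rw [h1]
    constructor
    · intro h j hj
      have h2 := hv' j _ (hWanti (show (b j).succ ≤ k from hj) h)
      rw [real_inner_comm, v.orthonormal.inner_right_fintype] at h2
      exact h2
    · intro h
      refine Submodule.sum_mem _ fun j _ => ?_
      rcases lt_or_ge (b j : ℕ) k with hj | hj
      · rw [h j hj, zero_smul]
        exact zero_mem _
      · exact Submodule.smul_mem _ _ (hWanti (show k ≤ (b j).castSucc from hj) (hv j))
  have hcol : ∀ j, glEquiv (c⁻¹ * o) (Pi.single j 1) = τ.symm (v j) := by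
    intro j
    rw [LinearEquiv.eq_symm_apply, hτo]
    simp [Pi.single_apply]
  obtain ⟨ε, t, ha⟩ := exists_adapted_rescale β (c⁻¹ * o) b hmem fun k i j hi hj hbi hbj hij => by
    have h1 := hpol k i j hbi hbj hij
    simp only [QuadraticMap.polar, QuadraticMap.comp_apply, map_add] at h1
    simp only [QuadraticMap.polar, hcol]
    exact h1
  refine ⟨_, _, ε, o, t, ha, ?_, rfl⟩
  rw [mul_assoc, mul_inv_cancel_left]

theorem exists_adapted (β : FlagForms F) :
    ∃ (g : GL (Fin n) ℝ) (b : Fin n → ℕ) (ε : Fin n → ℤˣ), Adapted β g b ε := by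
  obtain ⟨g, b, ε, -, -, h, -⟩ := exists_adapted_orthogonal β 1
  exact ⟨g, b, ε, h⟩

end OrthonormalAdapted

/-! ### Refinement read off from adapted bases -/

section Refinement

variable {n m m' : ℕ} {F : PartialFlag n m} {F' : PartialFlag n m'}

/-- Translation by `g * g'⁻¹` carries the basis `g'` to the basis `g`, so both flags can be
described in the coordinates of `g`. -/
theorem Adapted.mem_translate_iff {β' : FlagForms F'} {g' : GL (Fin n) ℝ} {b' : Fin n → ℕ}
    {ε' : Fin n → ℤˣ} (ha' : Adapted β' g' b' ε') (g : GL (Fin n) ℝ) (k : Fin (m' + 1))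
    (x : Fin n → ℝ) :
    x ∈ (F'.translate (g * g'⁻¹)).V k ↔ ∀ j, b' j < k → glEquiv g⁻¹ x j = 0 := by
  have h1 : ∀ x, glEquiv (g * g'⁻¹) (glEquiv g' x) = glEquiv g x := fun x => by
    rw [← glEquiv_mul, inv_mul_cancel_right]
  constructor
  · rintro ⟨y, hy, rfl⟩ j hj
    obtain ⟨v, rfl⟩ : ∃ v, y = glEquiv g' v := ⟨_, (glEquiv_apply_inv g' y).symm⟩
    change glEquiv g⁻¹ (glEquiv (g * g'⁻¹) (glEquiv g' v)) j = 0
    rw [h1, glEquiv_inv_apply]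
    exact (ha'.mem_iff k v).1 hy j hj
  · intro h
    refine ⟨glEquiv g' (glEquiv g⁻¹ x), (ha'.mem_iff k _).2 h, ?_⟩
    change glEquiv (g * g'⁻¹) (glEquiv g' (glEquiv g⁻¹ x)) = x
    rw [h1, glEquiv_apply_inv]

theorem coord_le_iff {g : GL (Fin n) ℝ} {A B : Submodule ℝ (Fin n → ℝ)} {p q : Fin n → Prop}
    (hA : ∀ x, x ∈ A ↔ ∀ j, p j → glEquiv g x j = 0)
    (hB : ∀ x, x ∈ B ↔ ∀ j, q j → glEquiv g x j = 0) : A ≤ B ↔ ∀ j, q j → p j := by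
  constructor
  · intro h j hj
    by_contra hp
    have h1 : glEquiv g⁻¹ (Pi.single j 1) ∈ A := by
      rw [hA]
      intro i hi
      rw [glEquiv_apply_inv, Pi.single_apply, if_neg]
      rintro rfl
      exact hp hi
    have h2 := (hB _).1 (h h1) j hj
    rw [glEquiv_apply_inv, Pi.single_eq_same] at h2
    exact one_ne_zero h2
  · intro h x hx
    rw [hB]
    exact fun j hj => (hA x).1 hx j (h j hj)

/-- Once the two bases are identified, `b'` refines the ordering of `b` and the signs coincide.
Signatures add up over the fine blocks of a coarse block, with no exchange, so `∅` serves. -/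
theorem refinesUpToConj_of_adapted {β : FlagForms F} {β' : FlagForms F'} {g g' : GL (Fin n) ℝ}
    {b b' : Fin n → ℕ} {ε : Fin n → ℤˣ} (ha : Adapted β g b ε) (ha' : Adapted β' g' b' ε)
    (hb : ∀ i j, b i < b j → b' i < b' j) : RefinesUpToConj β' β := by
  have hmem := ha.mem_iff'
  have hmem' := ha'.mem_translate_iff g
  refine ⟨g * g'⁻¹, fun i => ?_, ∅, fun i => ?_⟩
  · by_cases h : ∃ j, (i : ℕ) ≤ b j
    · obtain ⟨j₀, hj₀, hmin⟩ := Set.exists_min_image {j | (i : ℕ) ≤ b j} b' (Set.toFinite _) h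
      refine ⟨⟨b' j₀, (ha'.lt j₀).trans (Nat.lt_succ_self _)⟩, ?_⟩
      ext x
      rw [hmem', hmem]
      refine forall_congr' fun j => imp_congr_left ?_
      constructor
      · intro hj
        by_contra h'
        exact absurd (hmin j (not_lt.1 h')) (not_le.2 hj)
      · intro hj
        exact hb j j₀ (hj.trans_le hj₀)
    · push Not at h
      refine ⟨Fin.last m', ?_⟩
      ext x
      rw [hmem', hmem]
      exact forall_congr' fun j => imp_congr_left ⟨fun _ => h j, fun _ => ha'.lt j⟩
  · classical
    have hcond : ∀ j, ((F'.translate (g * g'⁻¹)).V (Fin.castSucc ⟨b' j, ha'.lt j⟩) ≤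
        F.V i.castSucc ∧ F.V i.succ < (F'.translate (g * g'⁻¹)).V
          (Fin.castSucc ⟨b' j, ha'.lt j⟩)) ↔ b j = i := by
      intro j
      rw [lt_iff_le_not_ge, coord_le_iff (hmem' _) (hmem _), coord_le_iff (hmem _) (hmem' _),
        coord_le_iff (hmem' _) (hmem _)]
      simp only [Fin.val_castSucc, Fin.val_succ]
      constructor
      · rintro ⟨h1, -, h2⟩
        push Not at h2
        obtain ⟨l, hl, hl'⟩ := h2
        have h3 : ¬ b l < b j := fun h => absurd (hb l j h) (not_lt.2 hl')
        have h4 : ¬ b j < i := fun h => lt_irrefl _ (h1 j h)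
        omega
      · intro hj
        refine ⟨fun l hl => hb l j (by omega), fun l hl => ?_, fun h => ?_⟩
        · by_contra h
          exact absurd (hb j l (by omega)) (by omega)
        · exact lt_irrefl _ (h j (by omega))
    simp only [Finset.notMem_empty, if_false]
    rw [ha.signature_eq, ← Finset.sum_fiberwise_of_maps_to
      (g := fun j => (⟨b' j, ha'.lt j⟩ : Fin m')) (t := Finset.univ.filter fun j =>
        (F'.translate (g * g'⁻¹)).V j.castSucc ≤ F.V i.castSucc ∧
        F.V i.succ < (F'.translate (g * g'⁻¹)).V j.castSucc)
      (fun j hj => Finset.mem_filter.2 ⟨Finset.mem_univ _,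
        (hcond j).2 (Finset.mem_filter.1 hj).2⟩)]
    refine Finset.sum_congr rfl fun k hk => ?_
    rw [ha'.signature_eq, Finset.filter_filter]
    refine Finset.sum_congr (Finset.filter_congr fun j _ => ?_) fun _ _ => rfl
    constructor
    · rintro ⟨-, h⟩
      exact congrArg Fin.val h
    · intro h
      have h1 : (⟨b' j, ha'.lt j⟩ : Fin m') = k := Fin.ext h
      refine ⟨(hcond j).1 ?_, h1⟩
      rw [h1]
      exact (Finset.mem_filter.1 hk).2

end Refinement

/-! ### Identification of all limits -/

section LimitGroups

/-- A strict weak order on a finite set is given by a rank function onto an initial segment. -/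
theorem exists_rank {n : ℕ} (r : Fin n → Fin n → Prop) (hirr : ∀ i, ¬ r i i)
    (htrans : ∀ i j k, r i j → r j k → r i k)
    (hinc : ∀ i j k, r i k → r i j ∨ r j k) :
    ∃ (m : ℕ) (b : Fin n → ℕ), (∀ j, b j < m) ∧ (∀ k < m, ∃ j, b j = k) ∧
      ∀ i j, r i j ↔ b i < b j := by
  classical
  -- Counting predecessors gives a rank function; its values are then compressed to an initial
  -- segment.
  let f : Fin n → ℕ := fun i => (Finset.univ.filter fun j => r j i).card
  have hf : ∀ i j, r i j ↔ f i < f j := by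
    intro i j
    constructor
    · intro h
      refine Finset.card_lt_card ⟨fun k hk => ?_, fun hsub => ?_⟩
      · simp only [Finset.mem_filter, Finset.mem_univ, true_and] at hk ⊢
        exact htrans k i j hk h
      · have := hsub (Finset.mem_filter.2 ⟨Finset.mem_univ i, h⟩)
        exact hirr i (Finset.mem_filter.1 this).2
    · intro h
      obtain ⟨k, hk, hk'⟩ := Finset.exists_mem_notMem_of_card_lt_card h
      simp only [Finset.mem_filter, Finset.mem_univ, true_and] at hk hk'
      exact (hinc k i j hk).resolve_left hk'
  let s := Finset.univ.image f
  let e := s.orderIsoOfFin rfl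
  have hs : ∀ j, f j ∈ s := fun j => Finset.mem_image_of_mem f (Finset.mem_univ j)
  refine ⟨s.card, fun j => e.symm ⟨f j, hs j⟩, fun j => Fin.is_lt _, fun k hk => ?_, fun i j => ?_⟩
  · obtain ⟨j, -, hj⟩ := Finset.mem_image.1 (e ⟨k, hk⟩).2
    refine ⟨j, ?_⟩
    have : (⟨f j, hs j⟩ : s) = e ⟨k, hk⟩ := Subtype.ext hj
    dsimp only
    rw [this, OrderIso.symm_apply_apply]
  · rw [hf, Fin.val_fin_lt, e.symm.lt_iff_lt, Subtype.mk_lt_mk]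

theorem exists_eventually_eq_of_finite {ι α : Type*} [Finite α] (u : Ultrafilter ι) (f : ι → α) :
    ∃ a, ∀ᶠ k in u, f k = a := by
  obtain ⟨a, ha⟩ := Ultrafilter.eq_pure_of_finite (u.map f)
  refine ⟨a, ?_⟩
  have : {a} ∈ u.map f := by rw [ha]; exact rfl
  exact this

theorem exists_tendsto_of_abs_le {ι : Type*} (u : Ultrafilter ι) {f : ι → ℝ}
    (h : ∀ᶠ k in u, |f k| ≤ 1) : ∃ c, Tendsto f u (𝓝 c) := by
  obtain ⟨c, -, hc⟩ := (isCompact_Icc (a := (-1 : ℝ)) (b := 1)).ultrafilter_le_nhds (u.map f) (by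
    rw [le_principal_iff]
    exact h.mono fun k hk => abs_le.1 hk)
  exact ⟨c, hc⟩

/-- Along an ultrafilter either `f` or its inverse is eventually in `[-1, 1]`, and compactness
applies. -/
theorem tendsto_trichotomy {ι : Type*} (u : Ultrafilter ι) (f : ι → ℝ) :
    Tendsto f u (𝓝 0) ∨ Tendsto (fun k => (f k)⁻¹) u (𝓝 0) ∨ ∃ c ≠ 0, Tendsto f u (𝓝 c) := by
  rcases u.em fun k => |f k| ≤ 1 with h | h
  · obtain ⟨c, hc⟩ := exists_tendsto_of_abs_le u h
    by_cases h0 : c = 0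
    · exact Or.inl (h0 ▸ hc)
    · exact Or.inr (Or.inr ⟨c, h0, hc⟩)
  · obtain ⟨c, hc⟩ := exists_tendsto_of_abs_le u (f := fun k => (f k)⁻¹) (h.mono fun k hk => by
      rw [abs_inv]
      exact inv_le_one_of_one_le₀ (not_le.1 hk).le)
    by_cases h0 : c = 0
    · exact Or.inr (Or.inl (h0 ▸ hc))
    · exact Or.inr (Or.inr ⟨c⁻¹, inv_ne_zero h0, by simpa using hc.inv₀ h0⟩)

variable {n : ℕ}

theorem tendsto_GL_of_val {ι : Type*} {l : Filter ι} {f : ι → GL (Fin n) ℝ} {g : GL (Fin n) ℝ}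
    (h : ∀ i j, Tendsto (fun k => (f k).val i j) l (𝓝 (g.val i j))) : Tendsto f l (𝓝 g) := by
  obtain ⟨f', hf', he⟩ := exists_tendsto_GL (M := fun k => (f k).val) (l := l) (u := g)
    (tendsto_pi_nhds.2 fun i => tendsto_pi_nhds.2 fun j => h i j)
  exact hf'.congr' (he.mono fun k hk => Units.ext hk)

/-- Compactness of the orthogonal group: entries are bounded by 1 and the orthogonality relations
pass to the limit. -/
theorem exists_tendsto_of_orthogonal {ι : Type*} (u : Ultrafilter ι) {o : ι → GL (Fin n) ℝ}
    (ho : ∀ k, (o k)⁻¹.val = (o k).val.transpose) : ∃ O, Tendsto o u (𝓝 O) := by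
  have hrow : ∀ k i l, ∑ j, (o k).val i j * (o k).val l j =
      (1 : Matrix (Fin n) (Fin n) ℝ) i l := by
    intro k i l
    rw [← Units.mul_inv (o k), ho, Matrix.mul_apply]
    rfl
  have hb : ∀ k i j, |(o k).val i j| ≤ 1 := by
    intro k i j
    have h1 := hrow k i i
    rw [Matrix.one_apply_eq] at h1
    have h2 := Finset.single_le_sum (f := fun j => (o k).val i j * (o k).val i j)
      (fun j _ => mul_self_nonneg _) (Finset.mem_univ j)
    rw [h1] at h2
    exact abs_le_one_iff_mul_self_le_one.2 h2
  choose M hM using fun i j => exists_tendsto_of_abs_le u (f := fun k => (o k).val i j)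
    (Eventually.of_forall fun k => hb k i j)
  have hMM : Matrix.of M * (Matrix.of M).transpose = 1 := by
    ext i l
    rw [Matrix.mul_apply]
    refine tendsto_nhds_unique (f := fun k => ∑ j, (o k).val i j * (o k).val l j) (l := (u : Filter ι))
      (tendsto_finsetSum _ fun j _ => (hM i j).mul (hM l j)) ?_
    simp only [hrow]
    exact tendsto_const_nhds
  exact ⟨⟨Matrix.of M, (Matrix.of M).transpose, hMM, mul_eq_one_comm.1 hMM⟩, tendsto_GL_of_val hM⟩

/-- Along an ultrafilter, an arbitrary family of diagonal matrices splits into a convergent factor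
and a factor that is constant on the classes of entries of comparable size. -/
theorem exists_split_diag {ι : Type*} (u : Ultrafilter ι) (t : ι → Fin n → ℝˣ) (b : Fin n → ℕ) :
    ∃ (m' : ℕ) (b' : Fin n → ℕ) (a s : ι → Fin n → ℝˣ) (α : Fin n → ℝˣ),
      (∀ j, b' j < m') ∧ (∀ k < m', ∃ j, b' j = k) ∧ (∀ k, t k = a k * s k) ∧
      (∀ j, Tendsto (fun k => (a k j : ℝ)) u (𝓝 (α j))) ∧
      (∀ i j, b i < b j → b' i < b' j) ∧
      (∀ i j, b' i = b' j → ∀ k, s k i = s k j) ∧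
      (∀ i j, b i = b j → b' i < b' j → Tendsto (fun k => (s k i : ℝ) / s k j) u (𝓝 0)) := by
  -- Order indices by coarse block, then by growth within a block; indices are incomparable when
  -- their ratio has a nonzero limit.
  let r : Fin n → Fin n → Prop := fun i j =>
    b i < b j ∨ (b i = b j ∧ Tendsto (fun k => (t k i : ℝ) / t k j) u (𝓝 0))
  have hmul : ∀ i j l k, (t k i : ℝ) / t k j * (t k j / t k l) = t k i / t k l := by
    intro i j l k
    have := (t k j).ne_zero
    field_simp
  have hirr : ∀ i, ¬ r i i := by
    rintro i (h | ⟨-, h⟩)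
    · exact lt_irrefl _ h
    · have : Tendsto (fun _ : ι => (1 : ℝ)) u (𝓝 0) :=
        h.congr fun k => div_self (t k i).ne_zero
      exact one_ne_zero (tendsto_nhds_unique tendsto_const_nhds this)
  have htrans : ∀ i j k, r i j → r j k → r i k := by
    rintro i j l (h | ⟨h, h'⟩) (g | ⟨g, g'⟩)
    · exact Or.inl (h.trans g)
    · exact Or.inl (g ▸ h)
    · exact Or.inl (h ▸ g)
    · refine Or.inr ⟨h.trans g, ?_⟩
      have := h'.mul g'
      simpa only [hmul, mul_zero] using this
  have htri : ∀ i j, r i j ∨ r j i ∨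
      (b i = b j ∧ ∃ c ≠ 0, Tendsto (fun k => (t k i : ℝ) / t k j) u (𝓝 c)) := by
    intro i j
    rcases lt_trichotomy (b i) (b j) with h | h | h
    · exact Or.inl (Or.inl h)
    · rcases tendsto_trichotomy u (fun k => (t k i : ℝ) / t k j) with h' | h' | h'
      · exact Or.inl (Or.inr ⟨h, h'⟩)
      · simp only [inv_div] at h'
        exact Or.inr (Or.inl (Or.inr ⟨h.symm, h'⟩))
      · exact Or.inr (Or.inr ⟨h, h'⟩)
    · exact Or.inr (Or.inl (Or.inl h))
  have hinc : ∀ i j k, r i k → r i j ∨ r j k := by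
    intro i j l hil
    rcases htri i j with h | h | ⟨h, c, hc, h'⟩
    · exact Or.inl h
    · exact Or.inr (htrans _ _ _ h hil)
    · right
      rcases hil with hil | ⟨hil, hil'⟩
      · exact Or.inl (h ▸ hil)
      · refine Or.inr ⟨h.symm.trans hil, ?_⟩
        have h1 := (h'.inv₀ hc).mul hil'
        simp only [inv_div, hmul, mul_zero] at h1
        exact h1
  obtain ⟨m', b', hlt, hsurj, hb'⟩ := exists_rank r hirr htrans hinc
  -- A representative of each class carries the common scale `s`; the quotients by it form the
  -- convergent factor `a`.
  let ρ : Fin n → Fin n := fun i => Set.rangeSplitting b' ⟨b' i, Set.mem_range_self i⟩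
  have hρ : ∀ i, b' (ρ i) = b' i := fun i => Set.apply_rangeSplitting b' ⟨b' i, _⟩
  have hcmp : ∀ i, b i = b (ρ i) ∧ ∃ c ≠ 0, Tendsto (fun k => (t k i : ℝ) / t k (ρ i)) u (𝓝 c) := by
    intro i
    rcases htri i (ρ i) with h | h | h
    · exact absurd ((hb' _ _).1 h) (by rw [hρ]; exact lt_irrefl _)
    · exact absurd ((hb' _ _).1 h) (by rw [hρ]; exact lt_irrefl _)
    · exact h
  choose hbρ α hα0 hα using hcmp
  refine ⟨m', b', fun k i => t k i / t k (ρ i), fun k i => t k (ρ i),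
    fun i => Units.mk0 _ (hα0 i), hlt, hsurj, fun k => ?_, fun i => ?_, fun i j h => ?_,
    fun i j h k => ?_, fun i j h h' => ?_⟩
  · funext i
    simp
  · simpa [div_eq_mul_inv] using hα i
  · exact (hb' i j).1 (Or.inl h)
  · have : ρ i = ρ j := by
      simp only [ρ]
      congr 1
      exact Subtype.ext h
    dsimp only
    rw [this]
  · rw [← hρ i, ← hρ j] at h'
    rcases (hb' _ _).2 h' with h1 | ⟨-, h1⟩
    · rw [← hbρ, ← hbρ, h] at h1
      exact absurd h1 (lt_irrefl _)
    · exact h1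

variable {m : ℕ} {F : PartialFlag n m}

/-- The limit is the block group of the finer numbering, conjugated by the limit of the orthogonal
factor times the convergent diagonal factor. That product is an adapted basis for the limiting flag.
-/
theorem exists_isom_eq_of_filterLim {ι : Type*} (u : Ultrafilter ι) (β : FlagForms F)
    (c : ι → GL (Fin n) ℝ) {L : Subgroup (GL (Fin n) ℝ)}
    (hL : FilterLim u (fun k => β.isom.map (MulAut.conj (c k)).toMonoidHom) L) :
    ∃ (m' : ℕ) (F' : PartialFlag n m') (β' : FlagForms F'),
      L = β'.isom ∧ RefinesUpToConj β' β := by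
  choose g b ε o t ha hco ho using fun k => exists_adapted_orthogonal β (c k)
  -- Block numbers and signs take finitely many values, hence are constant along the ultrafilter.
  obtain ⟨⟨b₀, ε₀⟩, hev⟩ := exists_eventually_eq_of_finite u
    fun k => ((fun j => ⟨b k j, (ha k).lt j⟩ : Fin n → Fin m), ε k)
  have hbε : ∀ᶠ k in u, b k = (fun j => (b₀ j : ℕ)) ∧ ε k = ε₀ := by
    filter_upwards [hev] with k hk
    obtain ⟨h1, h2⟩ := Prod.ext_iff.1 hk
    exact ⟨funext fun j => congrArg Fin.val (congrFun h1 j), h2⟩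
  obtain ⟨O, hO⟩ := exists_tendsto_of_orthogonal u ho
  obtain ⟨m', b', a, s, α, hlt, hsurj, hts, hα, h1, h2, h3⟩ :=
    exists_split_diag u t fun j => (b₀ j : ℕ)
  have hD : Tendsto (fun k => diagGL (a k)) u (𝓝 (diagGL α)) := by
    refine tendsto_GL_of_val fun i j => ?_
    simp only [diagGL_val, Matrix.diagonal_apply]
    split_ifs with hij
    · exact hα i
    · exact tendsto_const_nhds
  have hlim := (filterLim_diagGL (ε := ε₀) (l := (u : Filter ι)) h1 h2 h3).conj (hO.mul hD)
  obtain ⟨F', β', ha'⟩ := exists_adapted_of_basis (m := m') (O * diagGL α) b' ε₀ hlt hsurj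
  obtain ⟨k₀, hb₀, hε₀⟩ := hbε.exists
  have ha₀ := ha k₀
  rw [hb₀, hε₀] at ha₀
  refine ⟨m', F', β', ?_, refinesUpToConj_of_adapted ha₀ ha' h1⟩
  rw [ha'.isom_eq]
  refine hL.unique (hlim.congr ?_)
  filter_upwards [hbε] with k hk
  rw [(ha k).isom_eq, ← map_conj_mul, ← map_conj_mul, hco, hts, ← diagGL_mul, hk.1, hk.2,
    mul_assoc]

end LimitGroups

/-! ### Realizing refinements, and independence of the chosen forms -/

section RealizingRefinements

variable {n m m' : ℕ} {F : PartialFlag n m} {F' : PartialFlag n m'}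

/-- The permutation matrix acting on vectors by `x ↦ x ∘ π`. -/
def permGL (π : Equiv.Perm (Fin n)) : GL (Fin n) ℝ where
  val := π.toPEquiv.toMatrix
  inv := π.symm.toPEquiv.toMatrix
  val_inv := by
    rw [← PEquiv.toMatrix_trans, ← Equiv.toPEquiv_trans]
    simp
  inv_val := by
    rw [← PEquiv.toMatrix_trans, ← Equiv.toPEquiv_trans]
    simp

theorem glEquiv_permGL (π : Equiv.Perm (Fin n)) (x : Fin n → ℝ) (i : Fin n) :
    glEquiv (permGL π) x i = x (π i) := by
  change ∑ j, π.toPEquiv.toMatrix i j * x j = _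
  simp [PEquiv.toMatrix_apply]

theorem Adapted.perm {β : FlagForms F} {g : GL (Fin n) ℝ} {b : Fin n → ℕ} {ε : Fin n → ℤˣ}
    (ha : Adapted β g b ε) (π : Equiv.Perm (Fin n)) :
    Adapted β (g * permGL π.symm) (b ∘ π) (ε ∘ π) := by
  refine ⟨fun j => ha.lt _, fun k x => ?_, fun k x hx => ?_⟩
  · rw [glEquiv_mul, ha.mem_iff]
    simp only [glEquiv_permGL, Function.comp_apply]
    exact π.symm.forall_congr fun j => by simp
  · simp only [glEquiv_mul] at hx ⊢
    rw [ha.form_eq k _ hx]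
    simp only [glEquiv_permGL, Function.comp_apply]
    refine Finset.sum_equiv π.symm (fun j => by simp) fun j _ => by simp

theorem exists_perm_of_card_eq {α : Type*} [DecidableEq α] (p q : Fin n → α)
    (h : ∀ a, (Finset.univ.filter fun j => p j = a).card =
      (Finset.univ.filter fun j => q j = a).card) : ∃ π : Equiv.Perm (Fin n), p = q ∘ π := by
  have e : ∀ a, Nonempty ({j // p j = a} ≃ {j // q j = a}) := fun a =>
    ⟨Fintype.equivOfCardEq (by rw [Fintype.card_subtype, Fintype.card_subtype, h])⟩
  exact ⟨Equiv.ofFiberEquiv fun a => (e a).some, funext fun j => (Equiv.ofFiberEquiv_map _ j).symm⟩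

theorem card_filter_sign_eq {p q : Fin n → Prop} [DecidablePred p] [DecidablePred q]
    {ε ε' : Fin n → ℤˣ} (h : ∑ j with p j, sigUnit (ε j) = ∑ j with q j, sigUnit (ε' j)) (s : ℤˣ) :
    (Finset.univ.filter fun j => p j ∧ ε j = s).card =
      (Finset.univ.filter fun j => q j ∧ ε' j = s).card := by
  have key : ∀ (r : Fin n → Prop) [DecidablePred r] (δ : Fin n → ℤˣ),
      ((Finset.univ.filter fun j => r j ∧ δ j = -1).card,
        (Finset.univ.filter fun j => r j ∧ δ j = 1).card) = ∑ j with r j, sigUnit (δ j) := by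
    intro r _ δ
    ext
    · rw [Prod.fst_sum, ← Finset.filter_filter, Finset.card_filter]
      dsimp only
      refine Finset.sum_congr rfl fun j _ => ?_
      rcases Int.units_eq_one_or (δ j) with h | h <;> simp [sigUnit, h]
    · rw [Prod.snd_sum]
      dsimp only
      rw [← Finset.filter_filter, Finset.card_filter]
      refine Finset.sum_congr rfl fun j _ => ?_
      rcases Int.units_eq_one_or (δ j) with h | h <;> simp [sigUnit, h]
  rw [← key, ← key, Prod.mk.injEq] at h
  rcases Int.units_eq_one_or s with rfl | rfl
  · exact h.2
  · exact h.1

/-- Only products of signs within a block matter, so negating a form leaves the group unchanged;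
this accounts for the exchange of `p` and `q`. -/
theorem blockGroup_eq_of_sign {b : Fin n → ℕ} {ε ε' : Fin n → ℤˣ}
    (h : ∀ i j, b i = b j → sgn (ε i) * sgn (ε j) = sgn (ε' i) * sgn (ε' j)) :
    blockGroup b ε = blockGroup b ε' := by
  ext A
  exact ⟨fun hA => ⟨hA.left, hA.right, fun i j hij => by rw [hA.adj i j hij, h i j hij]⟩,
    fun hA => ⟨hA.left, hA.right, fun i j hij => by rw [hA.adj i j hij, h i j hij]⟩⟩

/-- Each piece of a refined flag lies in exactly one piece of the coarse flag. -/
theorem exists_coarse_index {T : PartialFlag n m'} (h : T.Refines F) :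
    ∃ φ : Fin m' → Fin m, Monotone φ ∧
      ∀ k i, T.V k.castSucc ≤ F.V i.castSucc ∧ F.V i.succ < T.V k.castSucc ↔ φ k = i := by
  have htotal : ∀ i k, F.V i ≤ T.V k ∨ T.V k ≤ F.V i := by
    intro i k
    obtain ⟨j, hj⟩ := h i
    rw [← hj]
    rcases le_total j k with hjk | hjk
    · exact Or.inr (T.strictAnti.antitone hjk)
    · exact Or.inl (T.strictAnti.antitone hjk)
  have hex : ∀ k : Fin m', ∃ i : Fin m,
      T.V k.castSucc ≤ F.V i.castSucc ∧ F.V i.succ < T.V k.castSucc := by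
    intro k
    by_contra hne
    push Not at hne
    -- Otherwise this fine step would lie in every coarse step, including 0.
    have hall : ∀ i, T.V k.castSucc ≤ F.V i := by
      intro i
      induction i using Fin.induction with
      | zero => rw [F.V_zero]; exact le_top
      | succ i ih =>
        rcases htotal i.succ k.castSucc with h' | h'
        · exact (h'.eq_of_not_lt (hne i ih)).ge
        · exact h'
    have h1 : T.V k.succ < T.V k.castSucc := T.strictAnti k.castSucc_lt_succ
    have h2 := hall (Fin.last m)
    rw [F.V_last] at h2
    exact not_lt_bot (h1.trans_le h2)
  choose φ hφ using hex
  have hle : ∀ (k k' : Fin m') (i i' : Fin m), k ≤ k' →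
      T.V k.castSucc ≤ F.V i.castSucc ∧ F.V i.succ < T.V k.castSucc →
      T.V k'.castSucc ≤ F.V i'.castSucc ∧ F.V i'.succ < T.V k'.castSucc → i ≤ i' := by
    intro k k' i i' hk hi hi'
    have h1 : F.V i'.succ < F.V i.castSucc :=
      hi'.2.trans_le ((T.strictAnti.antitone (Fin.castSucc_le_castSucc_iff.2 hk)).trans hi.1)
    have h2 := F.strictAnti.lt_iff_gt.1 h1
    exact Nat.lt_succ_iff.1 h2
  refine ⟨φ, fun k k' hk => hle k k' _ _ hk (hφ k) (hφ k'), fun k i => ⟨fun hi => ?_, ?_⟩⟩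
  · exact le_antisymm (hle k k _ _ le_rfl (hφ k) hi) (hle k k _ _ le_rfl hi (hφ k))
  · rintro rfl
    exact hφ k

theorem tendsto_pow_div_pow {p q : ℕ} (h : p < q) :
    Tendsto (fun k : ℕ => ((k : ℝ) + 1) ^ p / ((k : ℝ) + 1) ^ q) atTop (𝓝 0) := by
  have h1 : Tendsto (fun k : ℕ => (((k : ℝ) + 1) ^ (q - p))⁻¹) atTop (𝓝 0) :=
    tendsto_inv_atTop_zero.comp ((tendsto_pow_atTop (by omega)).comp
      (tendsto_natCast_atTop_atTop.atTop_add tendsto_const_nhds))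
  refine h1.congr fun k => ?_
  have h2 : ((k : ℝ) + 1) ≠ 0 := by positivity
  rw [← Nat.add_sub_cancel' h.le, pow_add, Nat.add_sub_cancel_left]
  field_simp

/-- Equality of signatures lets an adapted basis of `β` be permuted to have the signs of `β'`, up to
exchanges, with fine blocks inside coarse ones. Diagonal conjugation in this basis then splits the
forms. -/
theorem exists_filterLim_of_refinesUpToConj {β : FlagForms F} {β' : FlagForms F'}
    (h : RefinesUpToConj β' β) : ∃ c : ℕ → GL (Fin n) ℝ, ∀ l : Filter ℕ, l.NeBot → l ≤ atTop →
      FilterLim l (fun k => β.isom.map (MulAut.conj (c k)).toMonoidHom) β'.isom := by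
  classical
  obtain ⟨h₀, href, S, hsig⟩ := h
  obtain ⟨g, b, ε, ha⟩ := exists_adapted β
  obtain ⟨g', b', ε', ha'⟩ := exists_adapted β'
  obtain ⟨φ, hmono, hφ⟩ := exists_coarse_index href
  let κ : Fin n → Fin m' := fun j => ⟨b' j, ha'.lt j⟩
  -- The signs of `β'` after the exchanges prescribed by `S`; they add up to the signature of `β`.
  let δ : Fin n → ℤˣ := fun j => if κ j ∈ S then -ε' j else ε' j
  have hsum : ∀ i : Fin m, ∑ j with (φ (κ j) : ℕ) = i, sigUnit (δ j) =
      ∑ j with b j = i, sigUnit (ε j) := by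
    intro i
    rw [← ha.signature_eq, hsig i, ← Finset.sum_fiberwise_of_maps_to (g := κ)
      (t := Finset.univ.filter fun k => φ k = i)
      (fun j hj => Finset.mem_filter.2 ⟨Finset.mem_univ _, Fin.ext (Finset.mem_filter.1 hj).2⟩)]
    refine Finset.sum_congr (Finset.filter_congr fun k _ => (hφ k i).symm) fun k hk => ?_
    replace hk : φ k = i := (hφ k i).1 (Finset.mem_filter.1 hk).2
    have e : (Finset.univ.filter fun j => (φ (κ j) : ℕ) = i).filter (fun j => κ j = k) =
        Finset.univ.filter fun j => b' j = k := by
      rw [Finset.filter_filter]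
      refine Finset.filter_congr fun j _ => ⟨fun hj => congrArg Fin.val hj.2, fun hj => ?_⟩
      have h1 : κ j = k := Fin.ext hj
      exact ⟨by rw [h1, hk], h1⟩
    have hδ : ∀ j ∈ Finset.univ.filter (fun j => b' j = k),
        sigUnit (δ j) = if k ∈ S then (sigUnit (ε' j)).swap else sigUnit (ε' j) := by
      intro j hj
      have h1 : κ j = k := Fin.ext (Finset.mem_filter.1 hj).2
      simp only [δ, h1]
      split_ifs
      · exact sigUnit_neg _
      · rfl
    rw [e, Finset.sum_congr rfl hδ, ha'.signature_eq]
    split_ifs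
    · ext
      · simp [Prod.fst_sum, Prod.snd_sum]
      · simp [Prod.fst_sum, Prod.snd_sum]
    · rfl
  obtain ⟨π, hπ⟩ := exists_perm_of_card_eq (fun j => ((φ (κ j) : ℕ), δ j)) (fun j => (b j, ε j))
    (by
      rintro ⟨i, s⟩
      simp only [Prod.mk.injEq]
      by_cases hi : i < m
      · exact card_filter_sign_eq (hsum ⟨i, hi⟩) s
      · rw [Finset.filter_false_of_mem, Finset.filter_false_of_mem]
        · rintro j - ⟨rfl, -⟩
          exact hi (ha.lt j)
        · rintro j - ⟨rfl, -⟩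
          exact hi (φ _).2)
  have hπb : b ∘ π = fun j => (φ (κ j) : ℕ) :=
    funext fun j => (congrArg Prod.fst (congrFun hπ j)).symm
  have hπε : ε ∘ π = δ := funext fun j => (congrArg Prod.snd (congrFun hπ j)).symm
  have hp := ha.perm π
  rw [hπb, hπε] at hp
  generalize g * permGL π.symm = g₁ at hp
  have hδ : blockGroup b' ε' = blockGroup b' δ := by
    refine blockGroup_eq_of_sign fun i j hij => ?_
    have h1 : κ i = κ j := Fin.ext hij
    simp only [δ, h1]
    split_ifs
    · simp [sgn]
    · rfl
  -- These scales are constant on fine blocks, and the ratio of an earlier to a later block tends to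
  -- 0.
  let t : ℕ → Fin n → ℝˣ := fun k j =>
    Units.mk0 (((k : ℝ) + 1) ^ b' j) (pow_ne_zero _ (by positivity))
  refine ⟨fun k => g' * diagGL (t k) * g₁⁻¹, fun l hl hl' => ?_⟩
  have hlim := (filterLim_diagGL (b := fun j => (φ (κ j) : ℕ)) (b' := b') (ε := δ) (t := t) (l := l)
    (fun i j hij => by
      by_contra hne
      exact absurd (hmono (show κ j ≤ κ i from not_lt.1 hne)) (not_le.2 hij))
    (fun i j hij k => by simp only [t, hij])
    (fun i j _ hij => (tendsto_pow_div_pow hij).mono_left hl')).conj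
      (tendsto_const_nhds (x := g'))
  rw [ha'.isom_eq, hδ]
  refine hlim.congr (Eventually.of_forall fun k => ?_)
  rw [hp.isom_eq, ← map_conj_mul, ← map_conj_mul, inv_mul_cancel_right]

theorem isClosed_isom (β : FlagForms F) : IsClosed (β.isom : Set (GL (Fin n) ℝ)) := by
  obtain ⟨g, b, ε, ha⟩ := exists_adapted β
  rw [ha.isom_eq]
  exact isClosed_map_conj (isClosed_blockGroup b ε) g

/-- Refinement up to conjugation only depends on the isometry group of the finer flag. -/
theorem RefinesUpToConj.of_isom_eq {β : FlagForms F} {m₁ m₂ : ℕ} {F₁ : PartialFlag n m₁}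
    {F₂ : PartialFlag n m₂} {β₁ : FlagForms F₁} {β₂ : FlagForms F₂}
    (h : RefinesUpToConj β₁ β) (heq : β₁.isom = β₂.isom) : RefinesUpToConj β₂ β := by
  classical
  obtain ⟨g₁, b₁, ε₁, ha₁⟩ := exists_adapted β₁
  obtain ⟨g₂, b₂, ε₂, ha₂⟩ := exists_adapted β₂
  obtain ⟨hm, hF⟩ := flag_eq_of_isom_eq ha₁ ha₂ heq
  subst hm
  subst hF
  obtain ⟨g, href, S, hS⟩ := h
  have hsw := signature_eq_or_swap_of_isom_eq ha₁ heq
  -- Membership in `S` is kept where the signatures agree and toggled where they differ by a swap.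
  refine ⟨g, href, Finset.univ.filter fun k =>
    (k ∈ S ↔ β₂.signature k = β₁.signature k), fun i => ?_⟩
  rw [hS i]
  refine Finset.sum_congr rfl fun k _ => ?_
  simp only [Finset.mem_filter, Finset.mem_univ, true_and]
  rcases hsw k with h | h
  · simp [h]
  · by_cases h' : (β₁.signature k).swap = β₁.signature k
    · simp [h, h']
    · by_cases hk : k ∈ S <;> simp [h, h', hk]

end RealizingRefinements

/-! ### Passage to the projective group -/

section Projective

open Matrix.ProjGenLinGroup (mk mk_surjective mk_eq_mk_iff mk_scalar)

variable {n : ℕ}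

/-- The matrices of determinant `±1`. -/
def unimodular (n : ℕ) : Subgroup (GL (Fin n) ℝ) where
  carrier := {g | |g.val.det| = 1}
  one_mem' := by simp
  mul_mem' := by
    intro a b ha hb
    simp only [Set.mem_ofPred_eq] at ha hb ⊢
    rw [Units.val_mul, Matrix.det_mul, abs_mul, ha, hb, one_mul]
  inv_mem' := by
    intro a ha
    simp only [Set.mem_ofPred_eq] at ha ⊢
    have h : |a.val.det| * |(a⁻¹).val.det| = 1 := by
      rw [← abs_mul, ← Matrix.det_mul, Units.mul_inv, Matrix.det_one, abs_one]
    rwa [ha, one_mul] at h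

theorem mem_unimodular {g : GL (Fin n) ℝ} : g ∈ unimodular n ↔ |g.val.det| = 1 := Iff.rfl

theorem continuous_det_val : Continuous fun g : GL (Fin n) ℝ => g.val.det :=
  Units.continuous_val.matrix_det

theorem det_val_ne_zero (g : GL (Fin n) ℝ) : g.val.det ≠ 0 := by
  intro h
  have h1 : g.val.det * (g⁻¹).val.det = 1 := by
    rw [← Matrix.det_mul, Units.mul_inv, Matrix.det_one]
  rw [h, zero_mul] at h1
  exact zero_ne_one h1

/-- The positive multiple of `g` of determinant `±1`. -/
noncomputable def unimodularPart (g : GL (Fin n) ℝ) : GL (Fin n) ℝ :=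
  g * Matrix.GeneralLinearGroup.scalar (Fin n)
    (Units.mk0 (|g.val.det| ^ (-(n : ℝ)⁻¹)) (Real.rpow_pos_of_pos
      (abs_pos.2 (det_val_ne_zero g)) _).ne')

theorem mul_scalar_val (g : GL (Fin n) ℝ) (u : ℝˣ) :
    (g * Matrix.GeneralLinearGroup.scalar (Fin n) u).val = (u : ℝ) • g.val := by
  ext i j
  simp [Matrix.GeneralLinearGroup.scalar, mul_comm]

theorem unimodularPart_val (g : GL (Fin n) ℝ) :
    (unimodularPart g).val = |g.val.det| ^ (-(n : ℝ)⁻¹) • g.val := mul_scalar_val g _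

theorem mk_unimodularPart (g : GL (Fin n) ℝ) : mk (unimodularPart g) = mk g := by
  rw [unimodularPart, map_mul, mk_scalar, mul_one]

theorem unimodularPart_mem (g : GL (Fin n) ℝ) : unimodularPart g ∈ unimodular n := by
  rw [mem_unimodular, unimodularPart_val, Matrix.det_smul, Fintype.card_fin, abs_mul, abs_pow]
  rcases Nat.eq_zero_or_pos n with rfl | hn
  · simp
  · have h := abs_pos.2 (det_val_ne_zero g)
    have hn' : (n : ℝ) ≠ 0 := by positivity
    rw [abs_of_pos (Real.rpow_pos_of_pos h _), ← Real.rpow_natCast, ← Real.rpow_mul h.le,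
      neg_mul, inv_mul_cancel₀ hn', Real.rpow_neg_one, inv_mul_cancel₀ h.ne']

theorem unimodularPart_of_mem {g : GL (Fin n) ℝ} (hg : g ∈ unimodular n) : unimodularPart g = g := by
  apply Units.ext
  rw [unimodularPart_val, mem_unimodular.1 hg, Real.one_rpow, one_smul]

theorem continuous_unimodularPart : Continuous (unimodularPart : GL (Fin n) ℝ → GL (Fin n) ℝ) := by
  refine continuous_iff_continuousAt.2 fun g => tendsto_GL_of_val fun i j => ?_
  simp only [unimodularPart_val, Matrix.smul_apply, smul_eq_mul]
  refine Tendsto.mul ?_ ((continuous_entry i j).tendsto g)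
  exact ((continuous_det_val.abs.tendsto g).rpow_const
    (Or.inl (abs_pos.2 (det_val_ne_zero g)).ne'))

/-- The two matrices differ by a scalar whose `n`-th power has absolute value 1; for `n = 0` all
matrices coincide. -/
theorem eq_or_eq_neg_of_mk_eq {a b : GL (Fin n) ℝ} (h : mk a = mk b) (ha : a ∈ unimodular n)
    (hb : b ∈ unimodular n) : b = a ∨ b = -a := by
  obtain ⟨u, hu⟩ := mk_eq_mk_iff.1 h
  have hval : b.val = (u : ℝ) • a.val := by rw [← hu, mul_scalar_val]
  rcases Nat.eq_zero_or_pos n with rfl | hn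
  · exact Or.inl (Units.ext (Subsingleton.elim _ _))
  · rw [mem_unimodular, hval, Matrix.det_smul, Fintype.card_fin, abs_mul, abs_pow,
      mem_unimodular.1 ha, mul_one, pow_eq_one_iff_of_nonneg (abs_nonneg _) hn.ne'] at hb
    rcases eq_or_eq_neg_of_abs_eq hb with h1 | h1
    · exact Or.inl (Units.ext (by rw [hval, h1, one_smul]))
    · exact Or.inr (Units.ext (by rw [hval, h1, neg_smul, one_smul, Units.val_neg]))

theorem continuous_mk : Continuous (mk : GL (Fin n) ℝ → PGL(n, ℝ)) := continuous_coinduced_rng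

theorem mk_neg (g : GL (Fin n) ℝ) : mk (-g) = mk g := by
  rw [eq_comm, mk_eq_mk_iff]
  exact ⟨-1, Units.ext (by rw [mul_scalar_val]; simp)⟩

/-- Convergent families in the image of subgroups of matrices of determinant `±1` lift. -/
theorem exists_lift_tendsto {ι : Type*} {l : Filter ι} {H : ι → Subgroup (GL (Fin n) ℝ)}
    (hdet : ∀ k, H k ≤ unimodular n) (hneg : ∀ k, ∀ g ∈ H k, -g ∈ H k) {h : ι → PGL(n, ℝ)}
    (hh : ∀ᶠ k in l, h k ∈ (H k).map mk) {g : GL (Fin n) ℝ} (hg : g ∈ unimodular n)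
    (hlim : Tendsto h l (𝓝 (mk g))) :
    ∃ f : ι → GL (Fin n) ℝ, (∀ᶠ k in l, f k ∈ H k) ∧ Tendsto f l (𝓝 g) := by
  classical
  have hex : ∀ k, ∃ f, h k ∈ (H k).map mk → f ∈ H k ∧ mk f = h k := by
    intro k
    by_cases hk : h k ∈ (H k).map mk
    · obtain ⟨f, hf, hfk⟩ := hk
      exact ⟨f, fun _ => ⟨hf, hfk⟩⟩
    · exact ⟨1, fun h => absurd h hk⟩
  choose f₀ hf₀ using hex
  let φ : GL (Fin n) ℝ → ℝ := fun x => ∑ i, ∑ j, |x.val i j - g.val i j|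
  have hφ : Continuous φ := continuous_finsetSum _ fun i _ => continuous_finsetSum _ fun j _ =>
    ((continuous_entry i j).sub continuous_const).abs
  have hφg : φ g = 0 := by simp [φ]
  have hφ0 : ∀ x, 0 ≤ φ x := fun x =>
    Finset.sum_nonneg fun i _ => Finset.sum_nonneg fun j _ => abs_nonneg _
  -- Of the two lifts `f₀ k` and `-f₀ k`, take the one closer to `g` in the entrywise distance `φ`.
  let f : ι → GL (Fin n) ℝ := fun k => if φ (f₀ k) ≤ φ (-f₀ k) then f₀ k else -f₀ k
  have hmin : ∀ k, φ (f k) ≤ φ (f₀ k) ∧ φ (f k) ≤ φ (-f₀ k) := by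
    intro k
    simp only [f]
    split_ifs with hk
    · exact ⟨le_rfl, hk⟩
    · exact ⟨(not_le.1 hk).le, le_rfl⟩
  have hφf : Tendsto (fun k => φ (f k)) l (𝓝 0) := by
    refine tendsto_order.2 ⟨fun a ha => Eventually.of_forall fun k => ha.trans_le (hφ0 _),
      fun a ha => ?_⟩
    -- Classes with a determinant ±1 representative within `a` of `g`. The preimage of `Z` in `GL`
    -- is a union of two open sets, one for each sign, so `Z` is a neighbourhood of `mk g`.
    let Z : Set (PGL(n, ℝ)) := 
      {p | ∃ x, Matrix.ProjGenLinGroup.mk x = p ∧ φ (unimodularPart x) < a}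
    have hpre : mk ⁻¹' Z = {x | φ (unimodularPart x) < a} ∪ {x | φ (-unimodularPart x) < a} := by
      ext x
      constructor
      · rintro ⟨y, hy, hya⟩
        rw [← mk_unimodularPart y, ← mk_unimodularPart x] at hy
        rcases eq_or_eq_neg_of_mk_eq hy (unimodularPart_mem y) (unimodularPart_mem x) with hxy | hxy
        · exact Or.inl (by rw [Set.mem_ofPred_eq, hxy]; exact hya)
        · exact Or.inr (by rw [Set.mem_ofPred_eq, hxy, neg_neg]; exact hya)
      · rintro (hx | hx)
        · exact ⟨x, rfl, hx⟩
        · refine ⟨-unimodularPart x, by rw [mk_neg, mk_unimodularPart], ?_⟩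
          rw [unimodularPart_of_mem]
          · exact hx
          · have := mem_unimodular.1 (unimodularPart_mem x)
            rw [mem_unimodular, Units.val_neg, Matrix.det_neg, abs_mul, this]
            simp
    have hZ : IsOpen Z := by
      change IsOpen (mk ⁻¹' Z)
      rw [hpre]
      have hc := continuous_unimodularPart (n := n)
      have hcn : Continuous fun x : GL (Fin n) ℝ => -unimodularPart x := by
        refine continuous_iff_continuousAt.2 fun x => tendsto_GL_of_val fun i j => ?_
        simp only [Units.val_neg, Matrix.neg_apply]
        exact (((continuous_entry i j).comp hc).tendsto x).neg
      exact (isOpen_lt (hφ.comp hc) continuous_const).union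
        (isOpen_lt (hφ.comp hcn) continuous_const)
    have hgZ : mk g ∈ Z := ⟨g, rfl, by rw [unimodularPart_of_mem hg, hφg]; exact ha⟩
    filter_upwards [hh, hlim.eventually (hZ.mem_nhds hgZ)] with k hk hkZ
    obtain ⟨hfk, hfk'⟩ := hf₀ k hk
    rw [← hfk'] at hkZ
    have h1 : f₀ k ∈ mk ⁻¹' Z := hkZ
    rw [hpre] at h1
    rcases h1 with h1 | h1
    · rw [Set.mem_ofPred_eq, unimodularPart_of_mem (hdet k hfk)] at h1
      exact (hmin k).1.trans_lt h1
    · rw [Set.mem_ofPred_eq, unimodularPart_of_mem (hdet k hfk)] at h1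
      exact (hmin k).2.trans_lt h1
  refine ⟨f, hh.mono fun k hk => ?_, tendsto_GL_of_val fun i j => ?_⟩
  · simp only [f]
    split_ifs
    · exact (hf₀ k hk).1
    · exact hneg k _ (hf₀ k hk).1
  · rw [tendsto_iff_dist_tendsto_zero]
    refine squeeze_zero (fun k => dist_nonneg) (fun k => ?_) hφf
    rw [Real.dist_eq]
    exact (Finset.single_le_sum (f := fun j => |(f k).val i j - g.val i j|)
      (fun j _ => abs_nonneg _) (Finset.mem_univ j)).trans
      (Finset.single_le_sum (f := fun i => ∑ j, |(f k).val i j - g.val i j|)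
      (fun i _ => Finset.sum_nonneg fun j _ => abs_nonneg _) (Finset.mem_univ i))

section Limits

variable {ι : Type*} {l : Filter ι} {H : ι → Subgroup (GL (Fin n) ℝ)}

theorem FilterLim.map_mk (hdet : ∀ k, H k ≤ unimodular n) (hneg : ∀ k, ∀ g ∈ H k, -g ∈ H k)
    {L : Subgroup (GL (Fin n) ℝ)} (h : FilterLim l H L) :
    FilterLim l (fun k => (H k).map mk) (L.map mk) := by
  intro x
  constructor
  · rintro ⟨g, hg, rfl⟩
    obtain ⟨f, hf, hfg⟩ := (h g).1 hg
    exact ⟨fun k => mk (f k), hf.mono fun k hk => Subgroup.mem_map_of_mem _ hk,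
      (continuous_mk.tendsto g).comp hfg⟩
  · rintro ⟨f, hf, hfx⟩
    obtain ⟨g, rfl⟩ := mk_surjective x
    rw [← mk_unimodularPart g] at hfx ⊢
    obtain ⟨f', hf', hfg⟩ := exists_lift_tendsto hdet hneg hf (unimodularPart_mem g) hfx
    exact Subgroup.mem_map_of_mem _ ((h _).2 ⟨f', hf', hfg⟩)

/-- This turns a projective limit into a linear one, to which the classification in `GL` applies;
`map_mk_comap_inf` recovers the projective group. -/
theorem FilterLim.comap_mk [l.NeBot] (hdet : ∀ k, H k ≤ unimodular n)
    (hneg : ∀ k, ∀ g ∈ H k, -g ∈ H k) {L : Subgroup (PGL(n, ℝ))}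
    (h : FilterLim l (fun k => (H k).map mk) L) : FilterLim l H (L.comap mk ⊓ unimodular n) := by
  intro g
  constructor
  · rintro ⟨hg, hg'⟩
    obtain ⟨f, hf, hfg⟩ := (h (mk g)).1 hg
    exact exists_lift_tendsto hdet hneg hf hg' hfg
  · rintro ⟨f, hf, hfg⟩
    refine ⟨(h (mk g)).2 ⟨fun k => mk (f k), hf.mono fun k hk => Subgroup.mem_map_of_mem _ hk,
      (continuous_mk.tendsto g).comp hfg⟩, ?_⟩
    have h1 := (continuous_det_val.abs.tendsto g).comp hfg
    refine tendsto_nhds_unique (h1.congr' ?_) tendsto_const_nhds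
    exact hf.mono fun k hk => hdet k hk

end Limits

theorem map_mk_comap_inf (L : Subgroup (PGL(n, ℝ))) : (L.comap mk ⊓ unimodular n).map mk = L := by
  ext x
  constructor
  · rintro ⟨g, hg, rfl⟩
    exact hg.1
  · intro hx
    obtain ⟨g, rfl⟩ := mk_surjective x
    rw [← mk_unimodularPart g] at hx ⊢
    exact Subgroup.mem_map_of_mem _ (Subgroup.mem_inf.2 ⟨hx, unimodularPart_mem g⟩)

theorem comap_map_mk_inf {H : Subgroup (GL (Fin n) ℝ)} (hdet : H ≤ unimodular n)
    (hneg : ∀ g ∈ H, -g ∈ H) : (H.map mk).comap mk ⊓ unimodular n = H := by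
  ext g
  constructor
  · rintro ⟨⟨h, hh, hhg⟩, hg⟩
    rcases eq_or_eq_neg_of_mk_eq hhg (hdet hh) hg with rfl | rfl
    · exact hh
    · exact hneg _ hh
  · intro hg
    exact ⟨Subgroup.mem_map_of_mem _ hg, hdet hg⟩

/-- The preimage in `GL` is the preimage of `H` under the continuous map `unimodularPart`. -/
theorem isClosed_map_mk {H : Subgroup (GL (Fin n) ℝ)} (hdet : H ≤ unimodular n)
    (hneg : ∀ g ∈ H, -g ∈ H) (hH : IsClosed (H : Set (GL (Fin n) ℝ))) :
    IsClosed (H.map mk : Set (PGL(n, ℝ))) := by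
  have h : mk ⁻¹' (H.map mk : Set (PGL(n, ℝ))) = unimodularPart ⁻¹' (H : Set (GL (Fin n) ℝ)) := by
    ext g
    change mk g ∈ H.map mk ↔ unimodularPart g ∈ H
    rw [← mk_unimodularPart g]
    refine ⟨fun h => ?_, Subgroup.mem_map_of_mem _⟩
    rw [← comap_map_mk_inf hdet hneg]
    exact ⟨h, unimodularPart_mem g⟩
  rw [← isOpen_compl_iff]
  change IsOpen (mk ⁻¹' (H.map mk : Set (PGL(n, ℝ)))ᶜ)
  rw [Set.preimage_compl, h, isOpen_compl_iff]
  exact hH.preimage continuous_unimodularPart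

theorem map_mk_map_conj (H : Subgroup (GL (Fin n) ℝ)) (c : GL (Fin n) ℝ) :
    (H.map mk).map (MulAut.conj (mk c)).toMonoidHom =
      (H.map (MulAut.conj c).toMonoidHom).map mk := by
  rw [Subgroup.map_map, Subgroup.map_map]
  congr 1

theorem map_conj_le_unimodular {H : Subgroup (GL (Fin n) ℝ)} (hdet : H ≤ unimodular n)
    (c : GL (Fin n) ℝ) : H.map (MulAut.conj c).toMonoidHom ≤ unimodular n := by
  intro g hg
  have h := mem_unimodular.1 (hdet (mem_map_conj_iff.1 hg))
  rw [mem_unimodular, ← h, Units.val_mul, Units.val_mul, Matrix.det_mul, Matrix.det_mul,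
    mul_comm, ← mul_assoc, ← Matrix.det_mul, Units.mul_inv, Matrix.det_one, one_mul]

theorem neg_mem_map_conj {H : Subgroup (GL (Fin n) ℝ)} (hneg : ∀ g ∈ H, -g ∈ H)
    (c : GL (Fin n) ℝ) :
    ∀ g ∈ H.map (MulAut.conj c).toMonoidHom, -g ∈ H.map (MulAut.conj c).toMonoidHom := by
  intro g hg
  rw [mem_map_conj_iff] at hg ⊢
  simpa using hneg _ hg

variable {m : ℕ} {F : PartialFlag n m}

theorem isom_le_unimodular (β : FlagForms F) : β.isom ≤ unimodular n := by
  obtain ⟨g, b, ε, ha⟩ := exists_adapted β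
  rw [ha.isom_eq]
  exact map_conj_le_unimodular (fun A hA => abs_det_of_mem_blockGroup hA) g

theorem neg_mem_isom (β : FlagForms F) : ∀ g ∈ β.isom, -g ∈ β.isom := by
  obtain ⟨g, b, ε, ha⟩ := exists_adapted β
  rw [ha.isom_eq]
  refine neg_mem_map_conj (fun A hA =>
    mem_blockGroup.2 ⟨fun i j hij => ?_, fun i j hij => ?_, fun i j hij => ?_⟩) g
  · rw [Units.val_neg, Matrix.neg_apply, hA.left i j hij, neg_zero]
  · rw [inv_neg, Units.val_neg, Matrix.neg_apply, hA.right i j hij, neg_zero]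
  · rw [inv_neg, Units.val_neg, Units.val_neg, Matrix.neg_apply, Matrix.neg_apply,
      hA.adj i j hij, mul_neg]

theorem exists_isom_eq_of_isConjugacyLimit {β : FlagForms F} {L : Subgroup (GL (Fin n) ℝ)}
    (h : IsConjugacyLimit β.isom L) :
    ∃ (m' : ℕ) (F' : PartialFlag n m') (β' : FlagForms F'),
      L = β'.isom ∧ RefinesUpToConj β' β := by
  obtain ⟨c, hc⟩ := h
  exact exists_isom_eq_of_filterLim (hyperfilter ℕ) β c (hc.filterLim Nat.hyperfilter_le_atTop)

theorem exists_isom_eq_of_isConjugacyLimit_pIsom {β : FlagForms F} {L : Subgroup (PGL(n, ℝ))}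
    (h : IsConjugacyLimit β.pIsom L) :
    ∃ (m' : ℕ) (F' : PartialFlag n m') (β' : FlagForms F'),
      L.comap mk ⊓ unimodular n = β'.isom ∧ RefinesUpToConj β' β := by
  obtain ⟨c, hc⟩ := h
  choose C hC using fun k => mk_surjective (c k)
  have h1 := hc.filterLim (l := hyperfilter ℕ) Nat.hyperfilter_le_atTop
  simp only [← hC, FlagForms.pIsom, map_mk_map_conj] at h1
  exact exists_isom_eq_of_filterLim (hyperfilter ℕ) β C
    (h1.comap_mk (fun k => map_conj_le_unimodular (isom_le_unimodular β) _)
      fun k => neg_mem_map_conj (neg_mem_isom β) _)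

end Projective

/-! ### The main theorem -/

theorem mainTheorem8 (n m : ℕ) (F : PartialFlag n m) (β : FlagForms F) :
    ((∀ L : Subgroup (GL (Fin n) ℝ), IsConjugacyLimit β.isom L →
        ∃ (m' : ℕ) (F' : PartialFlag n m') (β' : FlagForms F'), L = β'.isom) ∧
      (∀ (m' : ℕ) (F' : PartialFlag n m') (β' : FlagForms F'),
        IsConjugacyLimit β.isom β'.isom ↔ RefinesUpToConj β' β)) ∧
    ((∀ L : Subgroup (PGL(n, ℝ)), IsConjugacyLimit β.pIsom L →
        ∃ (m' : ℕ) (F' : PartialFlag n m') (β' : FlagForms F'), L = β'.pIsom) ∧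
      (∀ (m' : ℕ) (F' : PartialFlag n m') (β' : FlagForms F'),
        IsConjugacyLimit β.pIsom β'.pIsom ↔ RefinesUpToConj β' β)) := by
  refine ⟨⟨fun L hL => ?_, fun m' F' β' => ⟨fun h => ?_, fun h => ?_⟩⟩,
    fun L hL => ?_, fun m' F' β' => ⟨fun h => ?_, fun h => ?_⟩⟩
  · obtain ⟨m', F', β', h, -⟩ := exists_isom_eq_of_isConjugacyLimit hL
    exact ⟨m', F', β', h⟩
  · obtain ⟨m'', F'', β'', h1, h2⟩ := exists_isom_eq_of_isConjugacyLimit h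
    -- The classification only yields some `β''` with the same group as `β'`; rigidity transfers the
    -- refinement to `β'`.
    exact h2.of_isom_eq h1.symm
  · obtain ⟨c, hc⟩ := exists_filterLim_of_refinesUpToConj h
    exact isConjugacyLimit_of_filterLim (isClosed_isom β) (isClosed_isom β') c hc
  · obtain ⟨m', F', β', h, -⟩ := exists_isom_eq_of_isConjugacyLimit_pIsom hL
    exact ⟨m', F', β', by rw [FlagForms.pIsom, ← h, map_mk_comap_inf]⟩
  · obtain ⟨m'', F'', β'', h1, h2⟩ := exists_isom_eq_of_isConjugacyLimit_pIsom h
    rw [FlagForms.pIsom, comap_map_mk_inf (isom_le_unimodular β') (neg_mem_isom β')] at h1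
    exact h2.of_isom_eq h1.symm
  · obtain ⟨c, hc⟩ := exists_filterLim_of_refinesUpToConj h
    have hdet := fun k => map_conj_le_unimodular (isom_le_unimodular β) (c k)
    have hneg := fun k => neg_mem_map_conj (neg_mem_isom β) (c k)
    refine ⟨fun k => Matrix.ProjGenLinGroup.mk (c k), ?_⟩
    simp only [FlagForms.pIsom, map_mk_map_conj]
    exact convergesGeometrically_of_filterLim
      (fun k => isClosed_map_mk (hdet k) (hneg k) (isClosed_map_conj (isClosed_isom β) _))
      (isClosed_map_mk (isom_le_unimodular β') (neg_mem_isom β') (isClosed_isom β'))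
      fun l hl hl' => (hc l hl hl').map_mk hdet hneg
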